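/- Let $k$ be a number field of degree $d>1$ with ring of integers $\mathfrak{o}$ and discriminant $\Delta$. Let $\Sigma$ be the set of the $d$ field embeddings $\sigma:k\hookrightarrow\mathbb{C}$, let $K\subset\mathbb{C}$ be the compositum of the fields $\sigma(k)$ for $\sigma\in\Sigma$, and let $G=\mathrm{Gal}(K/\mathbb{Q})$, acting on $\Sigma$ by $(g,\sigma)\mapsto g\circ\sigma$. Identify $k\otimes_{\mathbb{Q}}\mathbb{R}$ with the real vector space $$\{(z_\sigma)\in\mathbb{C}^\Sigma:\ z_{\overline{\sigma}}=\overline{z_\sigma}\text{ for all }\sigma\in\Sigma\},$$ equipped with the Euclidean norm $\|z\|=\bigl(\sum_{\sigma\in\Sigma}|z_\sigma|^2\bigr)^{1/2}$, in which $k$ is embedded by $x\mapsto(\sigma(x))_{\sigma\in\Sigma}$. Let $\mathfrak{n}\subset\mathfrak{o}$ be a nonzero ideal, embedded as a lattice in $k\otimes_{\mathbb{Q}}\mathbb{R}$, and let $\lambda_1\leq\dotsb\leq\lambda_d$ be its successive minima with respect to the closed unit ball centered at the origin, i.e. $\lambda_i$ is the infimum of the $r>0$ such that the closed ball of radius $r$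 about the origin contains $i$ linearly independent vectors of $\mathfrak{n}$. Write $[\mathfrak{o}:\mathfrak{n}]$ for the index of $\mathfrak{n}$ in $\mathfrak{o}$, and write $X\ll_d Y$ or $Y\gg_d X$ if $|X|\leq CY$ holds with a constant $C>0$ depending only on $d$. Then for all $m\in\{1,\dotsc,d-1\}$ we have $$\lambda_1\cdots\lambda_m\gg_d|\Delta|^{\max\left(0,\frac{m}{d}-\frac12\right)}[\mathfrak{o}:\mathfrak{n}]^{\frac{m}{d}},$$ $$\lambda_{m+1}\lambda_{m+2}\cdots\lambda_d\ll_d|\Delta|^{\min\left(\frac12,1-\frac{m}{d}\right)}[\mathfrak{o}:\mathfrak{n}]^{1-\frac{m}{d}}.$$ If moreover $G$ is $2$-homogeneous, that is, $G$ acts transitively on the set of $2$-element subsets of $\Sigma$, then $$\lambda_1\cdots\lambda_m\gg_d|\Delta|^{\frac{m(m-1)}{2d(d-1)}}[\mathfrak{o}:\mathfrak{n}]^{\frac{m}{d}},$$ $$\lambda_{m+1}\lambda_{m+2}\cdots\lambda_d\ll_d|\Delta|^{\frac{(d-m)(d+m-1)}{2d(d-1)}}[\mathfrak{o}:\mathfrak{n}]^{1-\frac{m}{d}}.$$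 -/

import Mathlib

noncomputable section

namespace IdealLatticeMinima

open NumberField

/-- The `i`-th successive minimum (`i ≥ 1`) of a lattice `L` in a normed real vector space, with
respect to the closed unit ball centered at the origin: the infimum of the radii `r > 0` such that
the closed ball of radius `r` contains `i` linearly independent vectors of `L`. -/
def successiveMinimum {E : Type*} [NormedAddCommGroup E] [NormedSpace ℝ E]
    (L : Submodule ℤ E) (i : ℕ) : ℝ :=
  sInf {r : ℝ | 0 < r ∧ ∃ v : Fin i → E, LinearIndependent ℝ v ∧
    ∀ j, v j ∈ L ∧ v j ∈ Metric.closedBall (0 : E) r}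

/-- The Euclidean space `k ⊗_ℚ ℝ`, realized as the real subspace of the vectors
`(z_σ)` in `ℂ^Σ` with `z_{σ̄} = conj z_σ`, where `Σ` is the set of complex embeddings of `k`.
Its norm is inherited from `ℂ^Σ`, that is, `‖z‖ ^ 2 = ∑ σ, |z_σ| ^ 2`. -/
def minkowskiSpace (k : Type*) [Field k] [NumberField k] :
    Submodule ℝ (EuclideanSpace ℂ (k →+* ℂ)) where
  carrier := {z | ∀ σ : k →+* ℂ, z (ComplexEmbedding.conjugate σ) = starRingEnd ℂ (z σ)}
  add_mem' := by
    intro a b ha hb σ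
    simp [ha σ, hb σ]
  zero_mem' := by
    intro σ
    simp
  smul_mem' := by
    intro c a ha σ
    simp [ha σ]

/-- The natural embedding `x ↦ (σ(x))_σ` of `k` into `k ⊗_ℚ ℝ`. -/
def minkowskiEmbedding (k : Type*) [Field k] [NumberField k] : k →ₗ[ℤ] minkowskiSpace k where
  toFun x := ⟨WithLp.toLp 2 (fun σ : k →+* ℂ => σ x), fun _ => rfl⟩
  map_add' := by
    intro x y
    ext σ
    simp
  map_smul' := by
    intro c x
    ext σ
    simp

/-- An ideal of the ring of integers, embedded in `k ⊗_ℚ ℝ`. -/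
def idealLattice (k : Type*) [Field k] [NumberField k] (𝔫 : Ideal (𝓞 k)) :
    Submodule ℤ (minkowskiSpace k) :=
  (𝔫.restrictScalars ℤ).map
    ((minkowskiEmbedding k).comp (Algebra.linearMap (𝓞 k) k |>.restrictScalars ℤ))

/-- The compositum of the fields `σ(k)`, where `σ` runs through the complex embeddings of `k`. -/
abbrev galoisClosure (k : Type*) [Field k] [NumberField k] : IntermediateField ℚ ℂ :=
  ⨆ σ : k →+* ℂ, σ.toRatAlgHom.fieldRange

/-- The action `(g, σ) ↦ g ∘ σ` of the Galois group of the compositum on the complex embeddings. -/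
def galoisAct {k : Type*} [Field k] [NumberField k]
    (g : galoisClosure k ≃ₐ[ℚ] galoisClosure k) (σ : k →+* ℂ) : k →+* ℂ where
  toFun x := g ⟨σ x, le_iSup (fun τ : k →+* ℂ => τ.toRatAlgHom.fieldRange) σ ⟨x, rfl⟩⟩
  map_one' := by
    simp only [map_one]
    exact congrArg Subtype.val (map_one g)
  map_mul' := by
    intro x y
    rw [← MulMemClass.coe_mul, ← map_mul]
    simp only [map_mul, MulMemClass.mk_mul_mk]
  map_zero' := by
    simp only [map_zero]
    exact congrArg Subtype.val (map_zero g)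
  map_add' := by
    intro x y
    rw [← AddMemClass.coe_add, ← map_add]
    simp only [map_add, AddMemClass.mk_add_mk]

/-- The Galois group of the compositum acts transitively on the two-element sets of embeddings. -/
def IsTwoHomogeneous (k : Type*) [Field k] [NumberField k] : Prop :=
  ∀ S T : Set (k →+* ℂ), S.ncard = 2 → T.ncard = 2 →
    ∃ g : galoisClosure k ≃ₐ[ℚ] galoisClosure k, galoisAct g '' S = T

end IdealLatticeMinima

end

/-!
Lower bounds come from determinants, upper bounds from Minkowski's second theorem.

Choose elements `x 1, …, x d` of the ideal `𝔫` whose images realize the successive minima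
(`exists_minimal_elements`). Minkowski's second theorem for a Euclidean ball
(`prod_norm_le_sqrt_det_gram`) bounds the product of all the minima by `|Δ| ^ (1/2) * N` up to a
constant, where `N` is the norm of `𝔫`. So the upper bound for the product of the last `d - m`
minima follows from the lower bound for the product of the first `m` (`upper_bound_of_lower_bound`).

For the lower bounds let `L` be the Galois closure. As `x 1, …, x m` are linearly independent, some
`m` embeddings `s i : k → L` give a nonzero determinant `δ = det (s i (x j))`, and the absolute
norm of `δ` is at most `(m! * ∏ ‖x j‖) ^ [L : ℚ]`, because every Galois conjugate of `δ` is again a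
determinant of this kind (`absNorm_span_embeddingDet_le`). To see that `δ` is divisible by a large
ideal, let `𝔡(σ, τ)` be the ideal of `𝓞 L` generated by the differences `σ x - τ x`
(`differenceIdeal`). Adding a further embedding `τ` to the rows of a minor multiplies the ideal of
all minors with entries from `𝔫` by at least `τ(𝔫) * ∏ 𝔡(τ, s i)`: combinations of columns
have all entries except the last equal to zero, with any prescribed element of that product in the
last place (`minorIdeal_mul_le`). After all the `d` embeddings have been adjoined, the determinants
are divisible by `N` and by the determinant of an integral basis, whose square is `Δ`
(`minorIdeal_le_span`). Hence the norm of `δ` times the norms of the ideals `𝔡(σ, τ)` of the pairs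
outside the minor is bounded from below (`rpow_discr_mul_rpow_absNorm_le`).

The norms of the ideals `𝔡(σ, τ)` are controlled by Hilbert's factorization of the different: each
embedding `σ` maps the different of `k` into `∏ 𝔡(σ, τ)`, the product over all `τ ≠ σ`
(`map_differentIdeal_le`). This holds since the different is generated by the values `f'(x)` at the
integral primitive elements `x` with minimal polynomial `f` (`differentIdeal_le_of_forall`), which
in turn means that each prime is prime to the conductor of some order `ℤ[x]`
(`exists_conductor_not_le`). For `m = d - 1` the pairs outside the minor are those containing one
fixed embedding, so that the product of their norms is at most a power of `|Δ|`. If the Galois group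
is 2-homogeneous, then all the ideals `𝔡(σ, τ)` have the same norm, and only the number of pairs
matters.

For arbitrary `k` the case `m = d - 1` and the bound for all `d` minima give
`λ_d ≪ (|Δ| * N) ^ (1/d)`, and then the bound for general `m`, if `m ≥ d / 2`. For smaller `m` it is
enough that `N ≤ |Norm x| ≤ ‖x‖ ^ d` for nonzero `x` in `𝔫` (`lower_bound_of_codim_one`).
-/

noncomputable section

namespace IdealLatticeMinima

open Module NumberField

/-! ### Minkowski's theorem on linear forms -/

open MeasureTheory in
/-- **Minkowski's theorem on linear forms**, with strict inequalities. -/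
theorem exists_int_vector_abs_mulVec_lt {d : ℕ} (B : Matrix (Fin d) (Fin d) ℝ) (hB : B.det ≠ 0)
    {r : ℝ} (hr : 0 < r) (h : |B.det| < r ^ d) :
    ∃ x : Fin d → ℤ, x ≠ 0 ∧ ∀ i, |B.mulVec (fun j => (x j : ℝ)) i| < r := by
  classical
  set s : Set (Fin d → ℝ) := Matrix.toLin' B ⁻¹' Metric.ball 0 r with hs
  have hdet : LinearMap.det (Matrix.toLin' B) ≠ 0 := by rwa [LinearMap.det_toLin']
  have hvol : volume s = ENNReal.ofReal (|B.det|⁻¹ * (2 * r) ^ d) := by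
    rw [hs, Measure.addHaar_preimage_linearMap _ hdet, Real.volume_pi_ball _ hr,
      LinearMap.det_toLin', abs_inv, ← ENNReal.ofReal_mul (by positivity), Fintype.card_fin]
  have hF := ZSpan.isAddFundamentalDomain' (Pi.basisFun ℝ (Fin d)) volume
  have hF1 : volume (ZSpan.fundamentalDomain (Pi.basisFun ℝ (Fin d))) = 1 := by
    simp [ZSpan.fundamentalDomain_pi_basisFun, Real.volume_pi_Ico]
  have : Countable (Submodule.span ℤ (Set.range (Pi.basisFun ℝ (Fin d)))).toAddSubgroup :=
    inferInstanceAs <| Countable (Submodule.span ℤ (Set.range (Pi.basisFun ℝ (Fin d))))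
  have hsymm : ∀ x ∈ s, -x ∈ s := fun x hx => by simpa [hs, Matrix.mulVec_neg] using hx
  have hconv : Convex ℝ s := (convex_ball _ _).linear_preimage _
  have hlt : volume (ZSpan.fundamentalDomain (Pi.basisFun ℝ (Fin d))) *
      2 ^ finrank ℝ (Fin d → ℝ) < volume s := by
    rw [hF1, hvol, one_mul, Module.finrank_fintype_fun_eq_card, Fintype.card_fin, mul_pow]
    have h2 : (2 : ENNReal) ^ d = ENNReal.ofReal (2 ^ d) := by
      rw [ENNReal.ofReal_pow (by norm_num)]; simp
    rw [h2]
    have hd0 : 0 < |B.det| := abs_pos.2 hB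
    apply (ENNReal.ofReal_lt_ofReal_iff (by positivity)).2
    rw [lt_inv_mul_iff₀ hd0]
    have : (0:ℝ) < 2 ^ d := by positivity
    nlinarith
  obtain ⟨x, hx0, hx⟩ :=
    exists_ne_zero_mem_lattice_of_measure_mul_two_pow_lt_measure hF hsymm hconv hlt
  obtain ⟨y, hy⟩ : ∃ y : Fin d → ℤ, (fun j => (y j : ℝ)) = (x : Fin d → ℝ) := by
    have h2 := (Basis.mem_span_iff_repr_mem ℤ (Pi.basisFun ℝ (Fin d)) (x : Fin d → ℝ)).1 x.2
    choose y hy using h2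
    refine ⟨y, ?_⟩
    ext j
    simpa using hy j
  refine ⟨y, ?_, fun i => ?_⟩
  · rintro rfl
    apply hx0
    apply Subtype.ext
    rw [← hy]
    ext j
    simp
  · rw [hy]
    have : Matrix.toLin' B (x : Fin d → ℝ) ∈ Metric.ball (0 : Fin d → ℝ) r := hx
    rw [mem_ball_zero_iff, pi_norm_lt_iff hr] at this
    simpa using this i

/-- A sequence whose terms are chosen one after the other, subject to a condition on the set of the
earlier terms. -/
theorem exists_seq_of_forall_exists {α : Type*} (Q : Set α → α → Prop) (h : ∀ A, ∃ y, Q A y) :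
    ∃ f : ℕ → α, ∀ n, Q (f '' Set.Iio n) (f n) := by
  choose F hF using h
  let g : ℕ → α := Nat.lt_wfRel.wf.fix fun n ih => F {y | ∃ m, ∃ hm : m < n, ih m hm = y}
  refine ⟨g, fun n => ?_⟩
  have : g n = F (g '' Set.Iio n) := by
    rw [show g n = F {y | ∃ m, ∃ _ : m < n, g m = y} from WellFounded.fix_eq _ _ _]
    congr 1
    ext y
    simp
  rw [this]
  exact hF _

open scoped InnerProductSpace

/-! ### Successive minima of Euclidean lattices -/

section SecondTheorem

variable {E : Type*} [NormedAddCommGroup E] [InnerProductSpace ℝ E] {d : ℕ}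

/-- The greedy choice of vectors realizing the successive minima: each vector is a shortest one
among the lattice vectors outside the span of its predecessors. -/
theorem exists_greedy (b : Basis (Fin d) ℝ E) :
    ∃ v : Fin d → E, (∀ i, v i ∈ Submodule.span ℤ (Set.range b)) ∧
      (∀ i, v i ∉ Submodule.span ℝ (v '' Set.Iio i)) ∧
      ∀ i, ∀ y ∈ Submodule.span ℤ (Set.range b), y ∉ Submodule.span ℝ (v '' Set.Iio i) →
        ‖v i‖ ≤ ‖y‖ := by
  classical
  have : FiniteDimensional ℝ E := b.finiteDimensional_of_finite
  set L := Submodule.span ℤ (Set.range b) with hL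
  obtain ⟨f, hf⟩ := exists_seq_of_forall_exists (α := E)
    (fun A y => (∃ z ∈ L, z ∉ Submodule.span ℝ A) →
      (y ∈ L ∧ y ∉ Submodule.span ℝ A ∧ ∀ z ∈ L, z ∉ Submodule.span ℝ A → ‖y‖ ≤ ‖z‖)) (by
    intro A
    by_cases h : ∃ z ∈ L, z ∉ Submodule.span ℝ A
    · obtain ⟨z, hz, hzA⟩ := h
      have hfin : (Metric.closedBall (0 : E) ‖z‖ ∩ (L : Set E)).Finite :=
        ZSpan.setFinite_inter b Metric.isBounded_closedBall
      have hfin2 : {y | y ∈ L ∧ y ∉ Submodule.span ℝ A ∧ ‖y‖ ≤ ‖z‖}.Finite :=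
        hfin.subset fun y hy => ⟨by simpa using hy.2.2, hy.1⟩
      obtain ⟨y, hy, hmin⟩ := Set.exists_min_image _ (fun y : E => ‖y‖) hfin2 ⟨z, hz, hzA, le_rfl⟩
      refine ⟨y, fun _ => ⟨hy.1, hy.2.1, fun w hw hwA => ?_⟩⟩
      by_cases hwz : ‖w‖ ≤ ‖z‖
      · exact hmin w ⟨hw, hwA, hwz⟩
      · exact hy.2.2.trans (le_of_not_ge hwz)
    · exact ⟨0, fun h' => absurd h' h⟩)
  have himg : ∀ i : Fin d, (fun j : Fin d => f j) '' Set.Iio i = f '' Set.Iio (i : ℕ) := by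
    intro i
    ext y
    constructor
    · rintro ⟨j, hj, rfl⟩
      exact ⟨j, hj, rfl⟩
    · rintro ⟨j, hj, rfl⟩
      exact ⟨⟨j, lt_trans hj i.2⟩, hj, rfl⟩
  have key : ∀ i : Fin d, ∃ z ∈ L, z ∉ Submodule.span ℝ (f '' Set.Iio (i : ℕ)) := by
    intro i
    by_contra! hcon
    have htop : Submodule.span ℝ (f '' Set.Iio (i : ℕ)) = ⊤ := by
      rw [eq_top_iff, ← b.span_eq, Submodule.span_le]
      rintro _ ⟨j, rfl⟩
      exact hcon _ (Submodule.subset_span ⟨j, rfl⟩)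
    have h1 : finrank ℝ (Submodule.span ℝ (f '' Set.Iio (i : ℕ))) ≤ i := by
      have := finrank_span_finset_le_card (R := ℝ) (M := E) ((Finset.Iio (i : ℕ)).image f)
      rw [Finset.coe_image, Finset.coe_Iio] at this
      exact this.trans (Finset.card_image_le.trans (by simp))
    rw [htop, finrank_top, finrank_eq_card_basis b, Fintype.card_fin] at h1
    exact absurd i.2 (not_lt.2 h1)
  refine ⟨fun i => f i, fun i => (hf i (key i)).1, fun i => ?_, fun i => ?_⟩
  · rw [himg]; exact (hf i (key i)).2.1
  · rw [himg]; exact (hf i (key i)).2.2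

theorem linearIndependent_of_notMem_span_Iio {n : ℕ} (v : Fin n → E)
    (h : ∀ i, v i ∉ Submodule.span ℝ (v '' Set.Iio i)) : LinearIndependent ℝ v := by
  induction n with
  | zero => exact linearIndependent_empty_type
  | succ n ih =>
    have hv : v = Fin.snoc (Fin.init v) (v (Fin.last n)) := (Fin.snoc_init_self v).symm
    rw [hv, linearIndependent_finSnoc]
    constructor
    · refine ih _ fun i hi => h i.castSucc ?_
      refine Submodule.span_mono ?_ hi
      rintro _ ⟨j, hj, rfl⟩
      exact ⟨j.castSucc, by simpa using hj, rfl⟩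
    · intro hi
      refine h (Fin.last n) (Submodule.span_mono ?_ hi)
      rintro _ ⟨j, rfl⟩
      exact ⟨j.castSucc, by simp, rfl⟩

/-- Greedily chosen vectors realize the successive minima: among `i + 1` linearly independent
lattice vectors, one lies outside the span of the first `i` greedy vectors. -/
theorem successiveMinimum_eq_norm (L : Submodule ℤ E) (v : Fin d → E)
    (hv : ∀ i, v i ∈ L)
    (hind : ∀ i, v i ∉ Submodule.span ℝ (v '' Set.Iio i))
    (hmin : ∀ i, ∀ y ∈ L, y ∉ Submodule.span ℝ (v '' Set.Iio i) → ‖v i‖ ≤ ‖y‖) (i : Fin d) :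
    successiveMinimum L (i + 1) = ‖v i‖ := by
  have hli := linearIndependent_of_notMem_span_Iio v hind
  have hmono : ∀ j ≤ i, ‖v j‖ ≤ ‖v i‖ := fun j hj => hmin j _ (hv i) fun hh =>
    hind i (Submodule.span_mono (Set.image_mono (Set.Iio_subset_Iio hj)) hh)
  apply le_antisymm
  · refine csInf_le ⟨0, fun r hr => hr.1.le⟩ ⟨norm_pos_iff.2 (hli.ne_zero i), ?_⟩
    refine ⟨fun j => v (Fin.castLE i.2 j), hli.comp _ (Fin.castLE_injective i.2),
      fun j => ⟨hv _, ?_⟩⟩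
    rw [mem_closedBall_zero_iff]
    exact hmono _ (by rw [Fin.le_def]; simp; omega)
  · refine le_csInf ?_ ?_
    · refine ⟨‖v i‖, norm_pos_iff.2 (hli.ne_zero i), fun j => v (Fin.castLE i.2 j),
        hli.comp _ (Fin.castLE_injective i.2), fun j => ⟨hv _, ?_⟩⟩
      rw [mem_closedBall_zero_iff]
      exact hmono _ (by rw [Fin.le_def]; simp; omega)
    · rintro r ⟨-, w, hw, hwr⟩
      obtain ⟨j, hj⟩ : ∃ j, w j ∉ Submodule.span ℝ (v '' Set.Iio i) := by
        by_contra! hcon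
        have hle : Submodule.span ℝ (Set.range w) ≤ Submodule.span ℝ (v '' Set.Iio i) := by
          rw [Submodule.span_le]
          rintro _ ⟨j, rfl⟩
          exact hcon j
        have : FiniteDimensional ℝ (Submodule.span ℝ (v '' Set.Iio i)) :=
          FiniteDimensional.span_of_finite ℝ (Set.toFinite _)
        have h1 := Submodule.finrank_mono hle
        rw [finrank_span_eq_card hw, Fintype.card_fin] at h1
        have h2 : finrank ℝ (Submodule.span ℝ (v '' Set.Iio i)) ≤ i := by
          classical
          have := finrank_span_finset_le_card (R := ℝ) (M := E) ((Finset.Iio i).image v)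
          rw [Finset.coe_image, Finset.coe_Iio] at this
          exact this.trans (Finset.card_image_le.trans (by simp))
        omega
      exact (hmin i _ (hwr j).1 hj).trans (by simpa using (hwr j).2)

/-- **Minkowski's second theorem**, upper bound, for a Euclidean ball. The box
`|⟪e i, y⟫| < r ‖v i‖` in an orthonormal basis `e` adapted to the vectors `v i` realizing the
successive minima contains no nonzero lattice vector as soon as `r ≤ 1 / √d`. -/
theorem prod_norm_le_sqrt_det_gram (b : Basis (Fin d) ℝ E) (v : Fin d → E)
    (hind : ∀ i, v i ∉ Submodule.span ℝ (v '' Set.Iio i))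
    (hmin : ∀ i, ∀ y ∈ Submodule.span ℤ (Set.range b), y ∉ Submodule.span ℝ (v '' Set.Iio i) →
        ‖v i‖ ≤ ‖y‖) :
    ∏ i, ‖v i‖ ≤ √d ^ d * √(Matrix.of fun i j => ⟪b i, b j⟫_ℝ).det := by
  classical
  rcases Nat.eq_zero_or_pos d with rfl | hd
  · simp
  have : FiniteDimensional ℝ E := b.finiteDimensional_of_finite
  have hli := linearIndependent_of_notMem_span_Iio v hind
  have hfr : finrank ℝ E = Fintype.card (Fin d) := finrank_eq_card_basis b
  have hv0 : ∀ i, 0 < ‖v i‖ := fun i => norm_pos_iff.2 (hli.ne_zero i)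
  set e := InnerProductSpace.gramSchmidtOrthonormalBasis hfr v
  set M : Matrix (Fin d) (Fin d) ℝ := Matrix.of fun i j => ⟪e i, b j⟫_ℝ with hM
  have hgram : (Matrix.of fun i j => ⟪b i, b j⟫_ℝ) = M.transpose * M := by
    ext i j
    simp only [Matrix.of_apply, Matrix.mul_apply, Matrix.transpose_apply, hM]
    rw [← e.sum_inner_mul_inner (b i) (b j)]
    exact Finset.sum_congr rfl fun l _ => by rw [real_inner_comm]
  have hMdet : M.det ≠ 0 := by
    have : M = e.toBasis.toMatrix b := by
      ext i j
      simp [hM, Basis.toMatrix_apply, OrthonormalBasis.repr_apply_apply]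
    rw [this]
    exact (e.toBasis.isUnit_det b).ne_zero
  rw [hgram, Matrix.det_mul, Matrix.det_transpose, Real.sqrt_mul_self_eq_abs]
  by_contra! hcon
  set B : Matrix (Fin d) (Fin d) ℝ := Matrix.diagonal (fun i => ‖v i‖⁻¹) * M with hB
  have hBdet : B.det = (∏ i, ‖v i‖)⁻¹ * M.det := by
    rw [hB, Matrix.det_mul, Matrix.det_diagonal, Finset.prod_inv_distrib]
  have hP : 0 < ∏ i, ‖v i‖ := Finset.prod_pos fun i _ => hv0 i
  have hsd : 0 < √(d : ℝ) := Real.sqrt_pos.2 (by exact_mod_cast hd)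
  obtain ⟨x, hx0, hx⟩ := exists_int_vector_abs_mulVec_lt B
    (by rw [hBdet]; exact mul_ne_zero (inv_ne_zero hP.ne') hMdet) (r := (√d)⁻¹) (by positivity) (by
      rw [hBdet, abs_mul, abs_inv, abs_of_pos hP, inv_pow, inv_mul_lt_iff₀ hP, ← div_eq_mul_inv,
        lt_div_iff₀ (by positivity)]
      linarith)
  set y : E := ∑ j, x j • b j with hy
  have hyL : y ∈ Submodule.span ℤ (Set.range b) :=
    Submodule.sum_mem _ fun j _ => Submodule.smul_mem _ _ (Submodule.subset_span ⟨j, rfl⟩)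
  have hy0 : y ≠ 0 := by
    intro h0
    apply hx0
    have h1 : ∑ j, (x j : ℝ) • b j = 0 := by simpa only [Int.cast_smul_eq_zsmul] using h0
    ext j
    exact_mod_cast Fintype.linearIndependent_iff.1 b.linearIndependent _ h1 j
  have hBx : ∀ i, B.mulVec (fun j => (x j : ℝ)) i = ‖v i‖⁻¹ * ⟪e i, y⟫_ℝ := by
    intro i
    rw [hB, ← Matrix.mulVec_mulVec, Matrix.mulVec_diagonal, hy, inner_sum]
    congr 1
    simp only [Matrix.mulVec, dotProduct, hM, Matrix.of_apply]
    refine Finset.sum_congr rfl fun j _ => ?_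
    rw [← Int.cast_smul_eq_zsmul ℝ, inner_smul_right, mul_comm]
  -- the last index `i` for which `y` lies outside the span of the vectors preceding `v i`
  obtain ⟨i, hi, hlast⟩ : ∃ i, y ∉ Submodule.span ℝ (v '' Set.Iio i) ∧
      ∀ j, i < j → ⟪e j, y⟫_ℝ = 0 := by
    have hne : (Finset.univ.filter fun i => y ∉ Submodule.span ℝ (v '' Set.Iio i)).Nonempty := by
      refine ⟨⟨0, hd⟩, ?_⟩
      have : (Set.Iio (⟨0, hd⟩ : Fin d)) = ∅ := by
        ext j; simp [Fin.lt_def]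
      simp [this, hy0]
    obtain ⟨i, hi, hmax⟩ := Finset.exists_max_image _ id hne
    refine ⟨i, (Finset.mem_filter.1 hi).2, fun j hj => ?_⟩
    have hyj : y ∈ Submodule.span ℝ (v '' Set.Iio j) := by
      by_contra hcon
      exact absurd (hmax j (by simpa using hcon)) (not_le.2 hj)
    have : Submodule.span ℝ (v '' Set.Iio j) ≤ LinearMap.ker (innerₛₗ ℝ (e j)) := by
      rw [Submodule.span_le]
      rintro _ ⟨l, hl, rfl⟩
      exact InnerProductSpace.gramSchmidtOrthonormalBasis_inv_triangular hfr v hl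
    exact this hyj
  have hnorm := hmin i y hyL hi
  have hmono : ∀ j ≤ i, ‖v j‖ ≤ ‖y‖ := fun j hj => hmin j y hyL fun hh =>
    hi (Submodule.span_mono (Set.image_mono (Set.Iio_subset_Iio hj)) hh)
  have h1 : ∑ j, ⟪e j, y⟫_ℝ ^ 2 = ‖y‖ ^ 2 := by
    have := e.sum_sq_norm_inner_right y
    simpa using this
  have hlt : ∀ j, ⟪e j, y⟫_ℝ ^ 2 < (d : ℝ)⁻¹ * ‖y‖ ^ 2 := by
    intro j
    rcases le_or_gt j i with hj | hj
    · have h2 := hx j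
      rw [hBx, abs_mul, abs_inv, abs_norm, inv_mul_lt_iff₀ (hv0 j)] at h2
      have h3 : |⟪e j, y⟫_ℝ| < ‖y‖ * (√d)⁻¹ :=
        h2.trans_le (mul_le_mul_of_nonneg_right (hmono j hj) (by positivity))
      calc ⟪e j, y⟫_ℝ ^ 2 = |⟪e j, y⟫_ℝ| ^ 2 := (sq_abs _).symm
        _ < (‖y‖ * (√d)⁻¹) ^ 2 := by gcongr
        _ = _ := by rw [mul_pow, inv_pow, Real.sq_sqrt (by positivity)]; ring
    · rw [hlast j hj]
      have : 0 < ‖y‖ := norm_pos_iff.2 hy0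
      have : (0 : ℝ) < d := by exact_mod_cast hd
      rw [zero_pow two_ne_zero]
      positivity
  have h2 : ∑ j, ⟪e j, y⟫_ℝ ^ 2 < ∑ _j : Fin d, (d : ℝ)⁻¹ * ‖y‖ ^ 2 :=
    Finset.sum_lt_sum_of_nonempty ⟨⟨0, hd⟩, Finset.mem_univ _⟩ fun j _ => hlt j
  rw [h1, Finset.sum_const, Finset.card_univ, Fintype.card_fin, nsmul_eq_mul, ← mul_assoc,
    mul_inv_cancel₀ (by positivity), one_mul] at h2
  exact lt_irrefl _ h2

end SecondTheorem

/-- The inner product of two vectors, recovered from the norm by polarization. It serves for real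
spaces such as `minkowskiSpace`, which are Euclidean but are given only with their norm. -/
def polarForm {E : Type*} [NormedAddCommGroup E] (x y : E) : ℝ :=
  (‖x + y‖ ^ 2 - ‖x‖ ^ 2 - ‖y‖ ^ 2) / 2

/-- Lattice vectors realizing the successive minima, together with the upper bound of Minkowski's
second theorem for their lengths. The space is a Euclidean space by virtue of the parallelogram
law. -/
theorem exists_realizing_vectors {E : Type*} [NormedAddCommGroup E] [NormedSpace ℝ E] {d : ℕ}
    (hpar : ∀ x y : E, ‖x + y‖ * ‖x + y‖ + ‖x - y‖ * ‖x - y‖ = 2 * (‖x‖ * ‖x‖ + ‖y‖ * ‖y‖))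
    (L : Submodule ℤ E) (w : Fin d → E) (hw : LinearIndependent ℝ w)
    (hspan : ⊤ ≤ Submodule.span ℝ (Set.range w))
    (hL : ∀ y, y ∈ L ↔ ∃ c : Fin d → ℤ, ∑ j, c j • w j = y) :
    ∃ v : Fin d → E, (∀ i, v i ∈ L) ∧ LinearIndependent ℝ v ∧
      (∀ i : Fin d, successiveMinimum L (i + 1) = ‖v i‖) ∧ (∀ i j, i ≤ j → ‖v i‖ ≤ ‖v j‖) ∧
      ∏ i, ‖v i‖ ≤ √d ^ d * √(Matrix.of fun i j => polarForm (w i) (w j)).det := by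
  let := InnerProductSpace.ofNorm ℝ hpar
  let b := Basis.mk hw hspan
  have hbw : ∀ i, b i = w i := fun i => Basis.mk_apply hw hspan i
  have hL' : L = Submodule.span ℤ (Set.range b) := by
    ext y
    rw [hL, Submodule.mem_span_range_iff_exists_fun]
    simp only [hbw]
  have hG : (Matrix.of fun i j => polarForm (w i) (w j)) = Matrix.of fun i j => ⟪b i, b j⟫_ℝ := by
    ext i j
    rw [Matrix.of_apply, Matrix.of_apply, hbw, hbw,
      real_inner_eq_norm_add_mul_self_sub_norm_mul_self_sub_norm_mul_self_div_two, polarForm]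
    simp only [sq]
  rw [hG]
  subst hL'
  obtain ⟨v, hv, hind, hmin⟩ := exists_greedy b
  exact ⟨v, hv, linearIndependent_of_notMem_span_Iio v hind,
    successiveMinimum_eq_norm _ v hv hind hmin,
    fun i j hij => hmin i _ (hv j) fun hh =>
      hind j (Submodule.span_mono (Set.image_mono (Set.Iio_subset_Iio hij)) hh),
    prod_norm_le_sqrt_det_gram b v hind hmin⟩

/-! ### Local generators at a prime of a Dedekind domain -/

section LocalGenerator

variable {R : Type*} [CommRing R] {P : Ideal R}

theorem mul_notMem_pow_succ [IsDedekindDomain R] [P.IsPrime] (hP : P ≠ ⊥) {a c : R} {i : ℕ}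
    (ha : a ∈ P) (ha2 : a ∉ P ^ 2) (hc : c ∉ P ^ i) : a * c ∉ P ^ (i + 1) := by
  intro h
  obtain ⟨Q, hQ⟩ := Ideal.dvd_span_singleton.2 ha
  have hPp : Prime P := Ideal.prime_of_isPrime hP inferInstance
  have hQP : ¬ P ∣ Q := by
    rintro ⟨Q', rfl⟩
    apply ha2
    rw [← Ideal.dvd_span_singleton, hQ, sq]
    exact ⟨Q', by rw [mul_assoc]⟩
  rw [← Ideal.dvd_span_singleton, ← Ideal.span_singleton_mul_span_singleton, hQ, pow_succ',
    mul_assoc] at h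
  have h2 := (mul_dvd_mul_iff_left hP).1 h
  exact hc (Ideal.dvd_span_singleton.1 (hPp.pow_dvd_of_dvd_mul_left i hQP h2))

theorem pow_notMem_pow_succ [IsDedekindDomain R] [P.IsPrime] (hP : P ≠ ⊥) {a : R} (ha : a ∈ P)
    (ha2 : a ∉ P ^ 2) (j : ℕ) : a ^ j ∉ P ^ (j + 1) := by
  induction j with
  | zero =>
    rw [pow_zero, zero_add, pow_one]
    exact (Ideal.ne_top_iff_one P).1 (Ideal.IsPrime.ne_top ‹_›)
  | succ j ih => rw [pow_succ' a j]; exact mul_notMem_pow_succ hP ha ha2 ih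

/-- An element whose powers represent all nonzero residue classes modulo `P` and for which
`x ^ q - x`, with `q` the size of the residue field, is a uniformizer at `P`. -/
structure IsLocalGenerator (P : Ideal R) (x : R) : Prop where
  notMem : x ∉ P
  pow_sub_mem : x ^ Nat.card (R ⧸ P) - x ∈ P
  pow_sub_notMem : x ^ Nat.card (R ⧸ P) - x ∉ P ^ 2
  exists_pow : ∀ y ∉ P, ∃ n : ℕ, y - x ^ n ∈ P

theorem pow_card_sub_mem [P.IsMaximal] [Finite (R ⧸ P)] (x : R) :
    x ^ Nat.card (R ⧸ P) - x ∈ P := by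
  let := Ideal.Quotient.field P
  let := Fintype.ofFinite (R ⧸ P)
  rw [← Ideal.Quotient.eq, map_pow, Nat.card_eq_fintype_card, FiniteField.pow_card]

/-- A lift `x` of a generator of the residue field is a local generator, or else `x + π` is one, for
any `π` in `P` but not in `P ^ 2`. -/
theorem exists_isLocalGenerator [IsDedekindDomain R] [P.IsMaximal] [Finite (R ⧸ P)] (hP : P ≠ ⊥) :
    ∃ x, IsLocalGenerator P x := by
  let := Ideal.Quotient.field P
  obtain ⟨ζ, hζ⟩ := IsCyclic.exists_generator (α := (R ⧸ P)ˣ)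
  obtain ⟨x, hx⟩ := Ideal.Quotient.mk_surjective (ζ : R ⧸ P)
  have hgen : ∀ z, z - x ∈ P → ∀ y ∉ P, ∃ n : ℕ, y - z ^ n ∈ P := by
    intro z hz y hy
    have hy0 : Ideal.Quotient.mk P y ≠ 0 := by rwa [Ne, Ideal.Quotient.eq_zero_iff_mem]
    obtain ⟨n, hn⟩ := (mem_powers_iff_mem_zpowers.2 (hζ (Units.mk0 _ hy0)))
    refine ⟨n, ?_⟩
    rw [← Ideal.Quotient.eq, map_pow, Ideal.Quotient.eq.2 hz, hx]
    have := congrArg Units.val hn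
    simpa using this.symm
  have hnot : ∀ z, z - x ∈ P → z ∉ P := by
    intro z hz
    rw [← Ideal.Quotient.eq_zero_iff_mem, Ideal.Quotient.eq.2 hz, hx]
    exact ζ.ne_zero
  by_cases h : x ^ Nat.card (R ⧸ P) - x ∈ P ^ 2
  swap
  · exact ⟨x, hnot x (by simp), pow_card_sub_mem x, h, hgen x (by simp)⟩
  obtain ⟨π, hπ, hπ2⟩ := Ideal.exists_mem_pow_notMem_pow_succ P hP
    (Ideal.IsPrime.ne_top inferInstance) 1
  rw [pow_one] at hπ
  refine ⟨x + π, hnot _ (by simpa), pow_card_sub_mem _, fun h2 => hπ2 ?_, hgen _ (by simpa)⟩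
  -- `(x + π) ^ q ≡ x ^ q` modulo `P ^ 2`, because `q` lies in `P`
  have hq : (Nat.card (R ⧸ P) : R) ∈ P := by
    rw [← Ideal.Quotient.eq_zero_iff_mem, map_natCast]
    let := Fintype.ofFinite (R ⧸ P)
    rw [Nat.card_eq_fintype_card]
    exact FiniteField.cast_card_eq_zero _
  set q := Nat.card (R ⧸ P)
  obtain ⟨c, hc⟩ := Polynomial.powAddExpansion x π q
  have e : π = (x ^ q - x) - ((x + π) ^ q - (x + π)) + (q * π) * x ^ (q - 1) + c * π ^ 2 := by
    rw [hc]; ring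
  rw [one_add_one_eq_two, e]
  refine Ideal.add_mem _ (Ideal.add_mem _ (Ideal.sub_mem _ h h2) (Ideal.mul_mem_right _ _ ?_))
    (Ideal.mul_mem_left _ _ (Ideal.pow_mem_pow hπ 2))
  rw [sq]
  exact Ideal.mul_mem_mul hq hπ

theorem IsLocalGenerator.of_sub_mem {x z : R} (hx : IsLocalGenerator P x) (h : z - x ∈ P ^ 2) :
    IsLocalGenerator P z := by
  have h1 : z - x ∈ P := Ideal.pow_le_self two_ne_zero h
  have hpow : ∀ n, z ^ n - x ^ n ∈ P ^ 2 := fun n =>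
    Ideal.mem_of_dvd _ (sub_dvd_pow_sub_pow z x n) h
  have hd : z ^ Nat.card (R ⧸ P) - z - (x ^ Nat.card (R ⧸ P) - x) ∈ P ^ 2 := by
    have := Ideal.sub_mem _ (hpow (Nat.card (R ⧸ P))) h
    convert this using 1; ring
  refine ⟨fun hz => hx.notMem ?_, ?_, fun hz => hx.pow_sub_notMem ?_, fun y hy => ?_⟩
  · simpa using Ideal.sub_mem _ hz h1
  · simpa using Ideal.add_mem _ (Ideal.pow_le_self two_ne_zero hd) hx.pow_sub_mem
  · simpa using Ideal.sub_mem _ hz hd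
  · obtain ⟨n, hn⟩ := hx.exists_pow y hy
    refine ⟨n, ?_⟩
    have := Ideal.sub_mem _ hn (Ideal.pow_le_self two_ne_zero (hpow n))
    simpa using this

/-- A local generator at `P` generates the `P`-adic completion over the integers. -/
theorem IsLocalGenerator.exists_sub_mem_pow [IsDedekindDomain R] [P.IsPrime] (hP : P ≠ ⊥) {x : R}
    (hx : IsLocalGenerator P x) (n : ℕ) (y : R) :
    ∃ h ∈ Algebra.adjoin ℤ {x}, y - h ∈ P ^ n := by
  have hxA : x ∈ Algebra.adjoin ℤ {x} := Algebra.self_mem_adjoin_singleton ℤ x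
  induction n with
  | zero => exact ⟨0, zero_mem _, by simp⟩
  | succ n ih =>
    obtain ⟨h, hh, hyh⟩ := ih
    obtain ⟨d, e, he, hde⟩ := Ideal.exists_mul_add_mem_pow_succ hP
      ((x ^ Nat.card (R ⧸ P) - x) ^ n) (y - h) (Ideal.pow_mem_pow hx.pow_sub_mem n)
      (pow_notMem_pow_succ hP hx.pow_sub_mem hx.pow_sub_notMem n) hyh
    obtain ⟨g, hg, hdg⟩ : ∃ g ∈ Algebra.adjoin ℤ {x}, d - g ∈ P := by
      by_cases hd : d ∈ P
      · exact ⟨0, zero_mem _, by simpa⟩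
      · obtain ⟨m, hm⟩ := hx.exists_pow d hd
        exact ⟨x ^ m, pow_mem hxA m, hm⟩
    refine ⟨h + (x ^ Nat.card (R ⧸ P) - x) ^ n * g,
      add_mem hh (mul_mem (pow_mem (sub_mem (pow_mem hxA _) hxA) n) hg), ?_⟩
    have : y - (h + (x ^ Nat.card (R ⧸ P) - x) ^ n * g)
        = (x ^ Nat.card (R ⧸ P) - x) ^ n * (d - g) + e := by
      linear_combination -hde
    rw [this]
    refine Ideal.add_mem _ ?_ he
    rw [pow_succ]
    exact Ideal.mul_mem_mul (Ideal.pow_mem_pow hx.pow_sub_mem n) hdg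

end LocalGenerator

/-! ### The different and conductors of monogenic orders -/

section Different

variable {k : Type*} [Field k] [NumberField k]

/-- If `θ` is primitive, then so is `x + c * θ` for some integer `c`, because `k` has only finitely
many subfields. -/
theorem exists_int_adjoin_add_eq_top (x θ : k) (hθ : IntermediateField.adjoin ℚ {θ} = ⊤) :
    ∃ c : ℤ, IntermediateField.adjoin ℚ {x + c * θ} = ⊤ := by
  have : Finite (IntermediateField ℚ k) :=
    Field.finite_intermediateField_of_exists_primitive_element ℚ k ⟨θ, hθ⟩
  obtain ⟨a, b, hab, h⟩ := Finite.exists_ne_map_eq_of_infinite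
    fun c : ℤ => IntermediateField.adjoin ℚ {x + c * θ}
  refine ⟨a, ?_⟩
  have ha : x + a * θ ∈ IntermediateField.adjoin ℚ {x + a * θ} :=
    IntermediateField.mem_adjoin_simple_self ℚ _
  have hb : x + b * θ ∈ IntermediateField.adjoin ℚ {x + a * θ} := by
    have h' : IntermediateField.adjoin ℚ {x + a * θ} = IntermediateField.adjoin ℚ {x + b * θ} := h
    rw [h']
    exact IntermediateField.mem_adjoin_simple_self ℚ _
  have hab' : (a - b : k) ≠ 0 := sub_ne_zero.2 (by exact_mod_cast hab)
  have hmem : θ ∈ IntermediateField.adjoin ℚ {x + a * θ} := by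
    have h1 := div_mem (sub_mem ha hb)
      (sub_mem (intCast_mem (IntermediateField.adjoin ℚ {x + a * θ}) a) (intCast_mem _ b))
    convert h1 using 1
    rw [eq_div_iff hab']
    ring
  rw [eq_top_iff, ← hθ]
  simpa using hmem

theorem exists_integral_primitive :
    ∃ θ : 𝓞 k, IntermediateField.adjoin ℚ {(θ : k)} = ⊤ := by
  obtain ⟨α, hα⟩ := Field.exists_primitive_element ℚ k
  obtain ⟨θ, n, hn, h⟩ : ∃ (θ : 𝓞 k) (n : ℤ), n ≠ 0 ∧ (θ : k) = n * α := by
    obtain ⟨n, hn, h⟩ := IsAlgebraic.exists_integral_multiple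
      ((IsFractionRing.isAlgebraic_iff ℤ ℚ k).2 (Algebra.IsAlgebraic.isAlgebraic (R := ℚ) α))
    exact ⟨⟨n • α, h⟩, n, hn, by simp⟩
  refine ⟨θ, ?_⟩
  rw [eq_top_iff, ← hα]
  have hθ := IntermediateField.mem_adjoin_simple_self ℚ (θ : k)
  have := div_mem hθ (intCast_mem (IntermediateField.adjoin ℚ {(θ : k)}) n)
  rw [h, mul_div_cancel_left₀ _ (by exact_mod_cast hn), ← h] at this
  simpa using this

/-- Every prime of a number field is prime to the conductor of some order `ℤ[x]`. The element `x`
generates locally at the prime, and is divisible by the other primes with the same residue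
characteristic. -/
theorem exists_conductor_not_le (P : Ideal (𝓞 k)) [P.IsPrime] (hP : P ≠ ⊥) :
    ∃ x : 𝓞 k, IntermediateField.adjoin ℚ {(x : k)} = ⊤ ∧ ¬ conductor ℤ x ≤ P := by
  have hPp : Prime P := Ideal.prime_of_isPrime hP inferInstance
  have : P.IsMaximal := Ideal.IsPrime.isMaximal inferInstance hP
  have : Finite (𝓞 k ⧸ P) := Ideal.finiteQuotientOfFreeOfNeBot P hP
  obtain ⟨p, hp, hpP⟩ : ∃ p : ℕ, p.Prime ∧ (p : 𝓞 k) ∈ P := by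
    let := Ideal.Quotient.field P
    obtain ⟨p, hp⟩ := CharP.exists (𝓞 k ⧸ P)
    refine ⟨p, (CharP.char_is_prime_or_zero (𝓞 k ⧸ P) p).resolve_right
      (CharP.char_ne_zero_of_finite (𝓞 k ⧸ P) p), ?_⟩
    rw [← Ideal.Quotient.eq_zero_iff_mem, map_natCast, CharP.cast_eq_zero]
  have hp0 : (p : 𝓞 k) ≠ 0 := by exact_mod_cast hp.ne_zero
  obtain ⟨Q, hQ, hPQ⟩ := (FiniteMultiplicity.of_prime_left hPp
    (b := Ideal.span {(p : 𝓞 k)}) (by simpa using hp0)).exists_eq_pow_mul_and_not_dvd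
  set e := multiplicity P (Ideal.span {(p : 𝓞 k)})
  have hpQ : (p : 𝓞 k) ∈ Q := by
    rw [← Ideal.dvd_span_singleton, hQ]; exact dvd_mul_left _ _
  have hcop : IsCoprime (P ^ 2) Q := by
    apply IsCoprime.pow_left
    rw [Ideal.isCoprime_iff_codisjoint, codisjoint_iff]
    by_contra hne
    have h1 : P ⊔ Q = P := (Ideal.IsMaximal.eq_of_le ‹_› hne le_sup_left).symm
    exact hPQ (Ideal.dvd_iff_le.2 (h1 ▸ le_sup_right))
  obtain ⟨x₀, hx₀⟩ := exists_isLocalGenerator hP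
  obtain ⟨i, hi, j, hj, hij⟩ := Ideal.isCoprime_iff_exists.1 hcop
  obtain ⟨θ, hθ⟩ := exists_integral_primitive (k := k)
  have hθ' : IntermediateField.adjoin ℚ {((p ^ 2 : ℕ) * (θ : k))} = ⊤ := by
    rw [eq_top_iff, ← hθ]
    have h1 := div_mem (IntermediateField.mem_adjoin_simple_self ℚ (((p ^ 2 : ℕ) : k) * (θ : k)))
      (natCast_mem (IntermediateField.adjoin ℚ {(((p ^ 2 : ℕ) : k) * (θ : k))}) (p ^ 2))
    rw [mul_div_cancel_left₀ _ (by exact_mod_cast pow_ne_zero 2 hp.ne_zero)] at h1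
    simpa using h1
  obtain ⟨c, hc⟩ := exists_int_adjoin_add_eq_top ((j * x₀ : 𝓞 k) : k) _ hθ'
  set x : 𝓞 k := j * x₀ + c * (p ^ 2 * θ) with hxdef
  have hxprim : IntermediateField.adjoin ℚ {(x : k)} = ⊤ := by
    rw [← hc]; congr 2; simp [hxdef]
  have hxgen : IsLocalGenerator P x := by
    refine hx₀.of_sub_mem ?_
    have : x - x₀ = c * (p ^ 2 * θ) - i * x₀ := by
      rw [hxdef]; linear_combination x₀ * hij
    rw [this]
    exact Ideal.sub_mem _
      (Ideal.mul_mem_left _ _ (Ideal.mul_mem_right _ _ (Ideal.pow_mem_pow hpP 2)))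
      (Ideal.mul_mem_right _ _ hi)
  have hxQ : x ∈ Q := Ideal.add_mem _ (Ideal.mul_mem_right _ _ hj)
    (Ideal.mul_mem_left _ _ (Ideal.mul_mem_right _ _ (Ideal.pow_mem_of_mem _ hpQ _ two_pos)))
  refine ⟨x, hxprim, fun hle => ?_⟩
  have hxtop : Algebra.adjoin ℚ {algebraMap (𝓞 k) k x} = ⊤ := by
    have := IntermediateField.adjoin_simple_toSubalgebra_of_isAlgebraic
      (Algebra.IsAlgebraic.isAlgebraic (R := ℚ) (x : k))
    rw [hxprim] at this
    rw [← this]; rfl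
  have hcond : conductor ℤ x ≠ ⊥ := by
    intro h0
    have h1 := conductor_mul_differentIdeal ℤ ℚ k x hxtop
    rw [h0, Ideal.bot_mul, eq_comm, Ideal.span_singleton_eq_bot] at h1
    have h2 := (Algebra.IsSeparable.isSeparable ℚ (x : k)).aeval_derivative_ne_zero
      (minpoly.aeval ℚ (x : k))
    apply h2
    rw [minpoly.isIntegrallyClosed_eq_field_fractions ℚ k
        (Algebra.IsIntegral.isIntegral (R := ℤ) x),
      Polynomial.derivative_map, Polynomial.aeval_map_algebraMap,
      Polynomial.aeval_algebraMap_apply, h1, map_zero]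
  set M := Ideal.absNorm (conductor ℤ x) with hM
  have hM0 : M ≠ 0 := by rwa [hM, Ne, Ideal.absNorm_eq_zero_iff]
  have hMmem : (M : 𝓞 k) ∈ conductor ℤ x := Ideal.absNorm_mem _
  obtain ⟨b, hb, hpb⟩ := (Nat.finiteMultiplicity_iff.2
    ⟨hp.ne_one, Nat.pos_of_ne_zero hM0⟩ : FiniteMultiplicity p M).exists_eq_pow_mul_and_not_dvd
  set a := multiplicity p M
  have hbP : (b : 𝓞 k) ∉ P := by
    intro hbP
    obtain ⟨u, v, huv⟩ := (Nat.Coprime.isCoprime ((hp.coprime_iff_not_dvd).2 hpb) :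
      IsCoprime (p : ℤ) (b : ℤ))
    apply (Ideal.ne_top_iff_one P).1 (Ideal.IsPrime.ne_top inferInstance)
    have : (u : 𝓞 k) * p + v * b = 1 := by exact_mod_cast congrArg (Int.cast : ℤ → 𝓞 k) huv
    rw [← this]
    exact Ideal.add_mem _ (Ideal.mul_mem_left _ _ hpP) (Ideal.mul_mem_left _ _ hbP)
  have hs : (b : 𝓞 k) * x ^ a ∉ P := by
    intro h
    rcases Ideal.IsPrime.mem_or_mem inferInstance h with h | h
    · exact hbP h
    · exact hxgen.notMem (Ideal.IsPrime.mem_of_pow_mem inferInstance _ h)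
  refine hs (hle ?_)
  rw [mem_conductor_iff]
  intro y
  obtain ⟨g, hg, hyg⟩ := hxgen.exists_sub_mem_pow hP (e * a) y
  have h1 : x ^ a * (y - g) ∈ Ideal.span {(p : 𝓞 k)} ^ a := by
    rw [hQ, mul_pow, ← pow_mul, mul_comm (x ^ a)]
    exact Ideal.mul_mem_mul hyg (Ideal.pow_mem_pow hxQ a)
  rw [Ideal.span_singleton_pow, Ideal.mem_span_singleton'] at h1
  obtain ⟨z, hz⟩ := h1
  have h2 : (b : 𝓞 k) * x ^ a * y = M * z + b * x ^ a * g := by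
    rw [hb]; push_cast; linear_combination (-(b : 𝓞 k)) * hz
  rw [h2]
  have hxA : x ∈ Algebra.adjoin ℤ {x} := Algebra.self_mem_adjoin_singleton ℤ x
  exact add_mem (mem_conductor_iff.1 hMmem z)
    (mul_mem (mul_mem (natCast_mem _ b) (pow_mem hxA a)) hg)

/-- The different is generated by the values `f'(x)`, where `x` runs through the integral primitive
elements and `f` is the minimal polynomial of `x`. -/
theorem differentIdeal_le_of_forall (I : Ideal (𝓞 k))
    (h : ∀ x : 𝓞 k, IntermediateField.adjoin ℚ {(x : k)} = ⊤ →
      Polynomial.aeval x (Polynomial.derivative (minpoly ℤ x)) ∈ I) :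
    differentIdeal ℤ (𝓞 k) ≤ I := by
  have htop : (⨆ x : {x : 𝓞 k // IntermediateField.adjoin ℚ {(x : k)} = ⊤},
      conductor ℤ (x : 𝓞 k)) = ⊤ := by
    by_contra hne
    obtain ⟨P, hPmax, hP⟩ := Ideal.exists_le_maximal _ hne
    have hP0 := Ring.ne_bot_of_isMaximal_of_not_isField hPmax (RingOfIntegers.not_isField k)
    have := hPmax.isPrime
    obtain ⟨x, hx, hxP⟩ := exists_conductor_not_le P hP0
    exact hxP ((le_iSup (fun x : {x : 𝓞 k // IntermediateField.adjoin ℚ {(x : k)} = ⊤} =>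
      conductor ℤ (x : 𝓞 k)) ⟨x, hx⟩).trans hP)
  rw [← Ideal.top_mul (differentIdeal ℤ (𝓞 k)), ← htop, Ideal.iSup_mul, iSup_le_iff]
  rintro ⟨x, hx⟩
  have hxtop : Algebra.adjoin ℚ {algebraMap (𝓞 k) k x} = ⊤ := by
    have := IntermediateField.adjoin_simple_toSubalgebra_of_isAlgebraic
      (Algebra.IsAlgebraic.isAlgebraic (R := ℚ) (x : k))
    rw [hx] at this
    rw [← this]; rfl
  rw [conductor_mul_differentIdeal ℤ ℚ k x hxtop, Ideal.span_singleton_le_iff_mem]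
  exact h x hx

end Different

/-! ### Difference ideals and ideals of minors -/

section Determinants

variable {k L : Type*} [Field k] [Field L]

/-- The ideal of `𝓞 L` generated by the differences `σ x - τ x`, for two embeddings `σ` and `τ` of
`k` into `L`. -/
def differenceIdeal (σ τ : k →+* L) : Ideal (𝓞 L) :=
  Ideal.span (Set.range fun x : 𝓞 k =>
    RingOfIntegers.mapRingHom σ x - RingOfIntegers.mapRingHom τ x)

theorem sub_mem_differenceIdeal (σ τ : k →+* L) (x : 𝓞 k) :
    RingOfIntegers.mapRingHom σ x - RingOfIntegers.mapRingHom τ x ∈ differenceIdeal σ τ :=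
  Ideal.subset_span ⟨x, rfl⟩

theorem differenceIdeal_comm (σ τ : k →+* L) : differenceIdeal σ τ = differenceIdeal τ σ := by
  apply le_antisymm <;>
  · refine Ideal.span_le.2 ?_
    rintro _ ⟨x, rfl⟩
    rw [SetLike.mem_coe, ← Ideal.neg_mem_iff, neg_sub]
    exact sub_mem_differenceIdeal _ _ x

open Polynomial in
/-- The conjugates of `f'(x)`, with `f` the minimal polynomial of a primitive element `x`, are the
products of the differences of the conjugates of `x`. The condition on the cardinality says that `L`
contains all the conjugates of `k`. -/
theorem map_aeval_derivative_minpoly [NumberField k] [NumberField L]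
    (hcard : Fintype.card (k →+* L) = finrank ℚ k)
    [DecidableEq (k →+* L)] (σ : k →+* L) (x : 𝓞 k)
    (hx : IntermediateField.adjoin ℚ {(x : k)} = ⊤) :
    RingOfIntegers.mapRingHom σ (aeval x (derivative (minpoly ℤ x))) =
      ∏ τ ∈ Finset.univ.erase σ,
        (RingOfIntegers.mapRingHom σ x - RingOfIntegers.mapRingHom τ x) := by
  set f : L[X] := (minpoly ℚ (x : k)).map (algebraMap ℚ L) with hf
  have hmon : f.Monic := (minpoly.monic (Algebra.IsIntegral.isIntegral _)).map _
  have hinj : Function.Injective fun τ : k →+* L => τ x := by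
    intro τ₁ τ₂ h
    have h1 : (τ₁.toRatAlgHom : k →ₐ[ℚ] L) = τ₂.toRatAlgHom := by
      apply AlgHom.ext_of_adjoin_eq_top (s := {(x : k)})
      · have := IntermediateField.adjoin_simple_toSubalgebra_of_isAlgebraic
          (Algebra.IsAlgebraic.isAlgebraic (R := ℚ) (x : k))
        rw [hx] at this
        rw [← this]; rfl
      · rintro _ rfl
        exact h
    ext y
    exact congrArg (fun g : k →ₐ[ℚ] L => g y) h1
  have hdvd : ∏ τ : k →+* L, (X - C (τ x)) ∣ f := by
    refine Finset.prod_dvd_of_coprime ?_ ?_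
    · intro τ₁ _ τ₂ _ h
      exact isCoprime_X_sub_C_of_isUnit_sub (sub_ne_zero.2 (hinj.ne h)).isUnit
    · intro τ _
      rw [dvd_iff_isRoot, IsRoot, hf, eval_map_algebraMap]
      have := congrArg τ.toRatAlgHom (minpoly.aeval ℚ (x : k))
      rw [← aeval_algHom_apply, map_zero] at this
      exact this
  have heq : f = ∏ τ : k →+* L, (X - C (τ x)) := by
    refine eq_of_monic_of_dvd_of_natDegree_le
      (monic_prod_of_monic _ _ fun τ _ => monic_X_sub_C _) hmon hdvd ?_
    rw [hf, natDegree_map, (Field.primitive_element_iff_minpoly_natDegree_eq ℚ (x : k)).1 hx,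
      natDegree_prod_of_monic _ _ fun τ _ => monic_X_sub_C _]
    simp [hcard]
  apply RingOfIntegers.ext
  have h1 : ((RingOfIntegers.mapRingHom σ (aeval x (derivative (minpoly ℤ x))) : 𝓞 L) : L)
      = eval (σ x) (derivative f) := by
    rw [hf, minpoly.isIntegrallyClosed_eq_field_fractions ℚ k
      (Algebra.IsIntegral.isIntegral (R := ℤ) x), derivative_map, derivative_map,
      eval_map_algebraMap, aeval_map_algebraMap]
    change σ (algebraMap (𝓞 k) k (aeval x (derivative (minpoly ℤ x)))) = _
    rw [← aeval_algebraMap_apply]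
    exact (aeval_algHom_apply (σ.toIntAlgHom) _ _).symm
  rw [h1, heq, ← Finset.mul_prod_erase Finset.univ _ (Finset.mem_univ σ), derivative_mul]
  simp [eval_prod, RingOfIntegers.mapRingHom_apply]

/-- Hilbert's factorization of the different, in the direction needed here: each embedding of `k`
maps the different into the product of the ideals `differenceIdeal σ τ`. -/
theorem map_differentIdeal_le [NumberField k] [NumberField L]
    (hcard : Fintype.card (k →+* L) = finrank ℚ k)
    [DecidableEq (k →+* L)] (σ : k →+* L) :
    (differentIdeal ℤ (𝓞 k)).map (RingOfIntegers.mapRingHom σ) ≤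
      ∏ τ ∈ Finset.univ.erase σ, differenceIdeal σ τ := by
  rw [Ideal.map_le_iff_le_comap]
  refine differentIdeal_le_of_forall _ fun x hx => ?_
  rw [Ideal.mem_comap, map_aeval_derivative_minpoly hcard σ x hx]
  exact Ideal.prod_mem_prod fun τ _ => sub_mem_differenceIdeal σ τ x

/-- The determinant of the matrix `(s i (v j))`. -/
def embeddingDet {m : ℕ} (s : Fin m → k →+* L) (v : Fin m → 𝓞 k) : 𝓞 L :=
  (Matrix.of fun i j => RingOfIntegers.mapRingHom (s i) (v j)).det

/-- The ideal generated by the determinants `(s i (v j))` with all the `v j` in `𝔫`. -/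
def minorIdeal (𝔫 : Ideal (𝓞 k)) {m : ℕ} (s : Fin m → k →+* L) : Ideal (𝓞 L) :=
  Ideal.span {z | ∃ v : Fin m → 𝓞 k, (∀ j, v j ∈ 𝔫) ∧ embeddingDet s v = z}

/-- The `𝓞 L`-module of columns spanned by the vectors `(s i a)_i` with `a ∈ 𝔫`. -/
def columnModule (𝔫 : Ideal (𝓞 k)) {m : ℕ} (s : Fin m → k →+* L) :
    Submodule (𝓞 L) (Fin m → 𝓞 L) :=
  Submodule.span (𝓞 L) ((fun a i => RingOfIntegers.mapRingHom (s i) a) '' (𝔫 : Set (𝓞 k)))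

theorem mul_mem_columnModule {𝔫 : Ideal (𝓞 k)} {m : ℕ} {s : Fin m → k →+* L}
    {w : Fin m → 𝓞 L} (hw : w ∈ columnModule 𝔫 s) (x : 𝓞 k) :
    (fun i => RingOfIntegers.mapRingHom (s i) x * w i) ∈ columnModule 𝔫 s := by
  induction hw using Submodule.span_induction with
  | mem w h =>
    obtain ⟨a, ha, rfl⟩ := h
    refine Submodule.subset_span ⟨x * a, Ideal.mul_mem_left _ _ ha, ?_⟩
    ext i
    simp
  | zero => convert zero_mem (columnModule 𝔫 s) using 1; ext i; simp
  | add w w' _ _ h h' =>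
    convert add_mem h h' using 1
    ext i
    simp [mul_add]
  | smul c w _ h =>
    convert Submodule.smul_mem _ c h using 1
    ext i
    simp [mul_left_comm]

/-- Any element `z` of the product of the difference ideals and of the conjugate of `𝔫` is the last
entry of a column with zeros in the rows in `T`. The zero in row `l` arises by multiplying each
entry `i` with `s i x - s l x`, which multiplies the last entry by a generator of the difference
ideal. -/
theorem exists_column_of_mem_prod {𝔫 : Ideal (𝓞 k)} {m : ℕ} (s : Fin (m + 1) → k →+* L)
    (T : Finset (Fin m)) {z : 𝓞 L}
    (hz : z ∈ (∏ i ∈ T, differenceIdeal (s (Fin.last m)) (s i.castSucc)) *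
      𝔫.map (RingOfIntegers.mapRingHom (s (Fin.last m)))) :
    ∃ w ∈ columnModule 𝔫 s, (∀ i ∈ T, w i.castSucc = 0) ∧ w (Fin.last m) = z := by
  classical
  induction T using Finset.induction_on generalizing z with
  | empty =>
    rw [Finset.prod_empty, one_mul] at hz
    induction hz using Submodule.span_induction with
    | mem z h =>
      obtain ⟨a, ha, rfl⟩ := h
      exact ⟨_, Submodule.subset_span ⟨a, ha, rfl⟩, by simp, rfl⟩
    | zero => exact ⟨0, zero_mem _, by simp, rfl⟩
    | add z z' _ _ h h' =>
      obtain ⟨w, hw, -, rfl⟩ := h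
      obtain ⟨w', hw', -, rfl⟩ := h'
      exact ⟨w + w', add_mem hw hw', by simp, rfl⟩
    | smul c z _ h =>
      obtain ⟨w, hw, -, rfl⟩ := h
      exact ⟨c • w, Submodule.smul_mem _ _ hw, by simp, rfl⟩
  | insert l T hl ih =>
    rw [Finset.prod_insert hl, mul_assoc] at hz
    induction hz using Submodule.mul_induction_on' with
    | mem_mul_mem y hy z hz =>
      obtain ⟨w, hw, hw0, rfl⟩ := ih hz
      induction hy using Submodule.span_induction with
      | mem y h =>
        obtain ⟨x, rfl⟩ := h
        refine ⟨(fun i => RingOfIntegers.mapRingHom (s i) x * w i) -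
          RingOfIntegers.mapRingHom (s l.castSucc) x • w,
          sub_mem (mul_mem_columnModule hw x) (Submodule.smul_mem _ _ hw), fun i hi => ?_, ?_⟩
        · rcases Finset.mem_insert.1 hi with rfl | hi
          · simp
          · simp [hw0 i hi]
        · simp [sub_mul]
      | zero => exact ⟨0, zero_mem _, by simp, by simp⟩
      | add y y' _ _ h h' =>
        obtain ⟨u, hu, hu0, hul⟩ := h
        obtain ⟨u', hu', hu0', hul'⟩ := h'
        exact ⟨u + u', add_mem hu hu', fun i hi => by simp [hu0 i hi, hu0' i hi],
          by simp [hul, hul', add_mul]⟩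
      | smul c y _ h =>
        obtain ⟨u, hu, hu0, hul⟩ := h
        exact ⟨c • u, Submodule.smul_mem _ _ hu, fun i hi => by simp [hu0 i hi],
          by simp [hul, mul_assoc]⟩
    | add y _ y' _ h h' =>
      obtain ⟨u, hu, hu0, hul⟩ := h
      obtain ⟨u', hu', hu0', hul'⟩ := h'
      exact ⟨u + u', add_mem hu hu', fun i hi => by simp [hu0 i hi, hu0' i hi],
        by simp [hul, hul']⟩

/-- The last column of a determinant may be replaced by any element of the column module; the
entry `0` of the tuple `Fin.snoc v 0` only fills the place of that column. -/
theorem det_updateCol_mem_minorIdeal {𝔫 : Ideal (𝓞 k)} {m : ℕ} (s : Fin (m + 1) → k →+* L)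
    {v : Fin m → 𝓞 k} (hv : ∀ j, v j ∈ 𝔫) {w : Fin (m + 1) → 𝓞 L} (hw : w ∈ columnModule 𝔫 s) :
    ((Matrix.of fun i j => RingOfIntegers.mapRingHom (s i) ((Fin.snoc v 0 : Fin (m + 1) → 𝓞 k) j)
      ).updateCol (Fin.last m) w).det ∈ minorIdeal 𝔫 s := by
  induction hw using Submodule.span_induction with
  | mem w h =>
    obtain ⟨a, ha, rfl⟩ := h
    refine Ideal.subset_span ⟨Fin.snoc v a, fun j => ?_, ?_⟩
    · refine Fin.lastCases ?_ (fun j => ?_) j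
      · simpa using ha
      · simpa using hv j
    · rw [embeddingDet]
      congr 1
      ext i j
      refine Fin.lastCases ?_ (fun j => ?_) j
      · simp
      · simp
  | zero =>
    rw [Matrix.det_eq_zero_of_column_eq_zero (Fin.last m) (by simp)]
    exact zero_mem _
  | add w w' _ _ h h' => rw [Matrix.det_updateCol_add]; exact add_mem h h'
  | smul c w _ h => rw [Matrix.det_updateCol_smul]; exact Ideal.mul_mem_left _ _ h

/-- Adding one embedding to the rows: Laplace expansion along a column whose only nonzero entry is
the new one. -/
theorem minorIdeal_mul_le (𝔫 : Ideal (𝓞 k)) {m : ℕ} (s : Fin (m + 1) → k →+* L) :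
    minorIdeal 𝔫 (fun i : Fin m => s i.castSucc) *
      ((∏ i : Fin m, differenceIdeal (s (Fin.last m)) (s i.castSucc)) *
        𝔫.map (RingOfIntegers.mapRingHom (s (Fin.last m)))) ≤ minorIdeal 𝔫 s := by
  rw [minorIdeal, Ideal.mul_le]
  intro y hy z hz
  obtain ⟨w, hw, hw0, rfl⟩ := exists_column_of_mem_prod s Finset.univ hz
  induction hy using Submodule.span_induction with
  | mem y h =>
    obtain ⟨v, hv, rfl⟩ := h
    have h1 := det_updateCol_mem_minorIdeal s hv hw
    rw [Matrix.det_succ_column _ (Fin.last m), Fin.sum_univ_castSucc] at h1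
    have h2 : ((Matrix.of fun i j => RingOfIntegers.mapRingHom (s i)
          ((Fin.snoc v 0 : Fin (m + 1) → 𝓞 k) j)).updateCol (Fin.last m) w).submatrix
        (Fin.last m).succAbove (Fin.last m).succAbove =
        Matrix.of fun (i : Fin m) j => RingOfIntegers.mapRingHom (s i.castSucc) (v j) := by
      ext i j
      simp
    rw [h2] at h1
    simp only [Matrix.updateCol_self, hw0 _ (Finset.mem_univ _), mul_zero, zero_mul,
      Finset.sum_const_zero, zero_add, Fin.val_last, Even.neg_one_pow ⟨m, rfl⟩, one_mul] at h1
    rw [mul_comm]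
    exact h1
  | zero => simp
  | add y y' _ _ h h' => rw [add_mul]; exact add_mem h h'
  | smul c y _ h => rw [smul_mul_assoc]; exact Submodule.smul_mem _ c h

theorem embeddingDet_eq_mul {d : ℕ} (b : Basis (Fin d) ℤ (𝓞 k)) (s : Fin d → k →+* L)
    (v : Fin d → 𝓞 k) : embeddingDet s v = embeddingDet s b * (b.det v : ℤ) := by
  have : (Matrix.of fun i j => RingOfIntegers.mapRingHom (s i) (v j)) =
      (Matrix.of fun i j => RingOfIntegers.mapRingHom (s i) (b j)) *
        (b.toMatrix v).map (Int.castRingHom (𝓞 L)) := by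
    ext i j
    rw [Matrix.of_apply, Matrix.mul_apply]
    conv_lhs => rw [← b.sum_repr (v j), map_sum]
    simp [Basis.toMatrix_apply, mul_comm]
  rw [embeddingDet, this, Matrix.det_mul, Basis.det_apply, embeddingDet]
  congr 1
  exact ((Int.castRingHom (𝓞 L)).map_det _).symm

theorem absNorm_dvd_det [NumberField k] {d : ℕ} (b : Basis (Fin d) ℤ (𝓞 k)) {𝔫 : Ideal (𝓞 k)}
    (h𝔫 : 𝔫 ≠ ⊥) {v : Fin d → 𝓞 k} (hv : ∀ j, v j ∈ 𝔫) :
    (Ideal.absNorm 𝔫 : ℤ) ∣ b.det v := by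
  let c : Basis (Fin d) ℤ 𝔫 := 𝔫.selfBasis b h𝔫
  let f := b.det.compLinearMap (𝔫.subtype.restrictScalars ℤ)
  have h1 : b.det v = f fun j => ⟨v j, hv j⟩ := rfl
  have h2 := f.eq_smul_basis_det c
  rw [h1, h2, AlternatingMap.smul_apply, smul_eq_mul]
  apply Dvd.dvd.mul_right
  rw [← Ideal.natAbs_det_basis_change b 𝔫 c, Int.natAbs_dvd]
  exact dvd_refl _

/-- The ideal of the full minors is divisible by the norm of `𝔫` and by the determinant of an
integral basis. -/
theorem minorIdeal_le_span [NumberField k] {d : ℕ} (b : Basis (Fin d) ℤ (𝓞 k)) {𝔫 : Ideal (𝓞 k)}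
    (h𝔫 : 𝔫 ≠ ⊥) (s : Fin d → k →+* L) :
    minorIdeal 𝔫 s ≤ Ideal.span {embeddingDet s b * (Ideal.absNorm 𝔫 : 𝓞 L)} := by
  refine Ideal.span_le.2 ?_
  rintro _ ⟨v, hv, rfl⟩
  rw [SetLike.mem_coe, Ideal.mem_span_singleton, embeddingDet_eq_mul b s v]
  obtain ⟨c, hc⟩ := absNorm_dvd_det b h𝔫 hv
  rw [hc]
  exact ⟨c, by push_cast; ring⟩

theorem map_differenceIdeal (g : L →+* L) (σ τ : k →+* L) :
    (differenceIdeal σ τ).map (RingOfIntegers.mapRingHom g) =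
      differenceIdeal (g.comp σ) (g.comp τ) := by
  rw [differenceIdeal, Ideal.map_span, differenceIdeal, ← Set.range_comp]
  congr 2
  ext x
  simp

theorem differenceIdeal_ne_bot [NumberField k] {σ τ : k →+* L} (h : σ ≠ τ) :
    differenceIdeal σ τ ≠ ⊥ := by
  intro h0
  apply h
  have h1 : ∀ x : 𝓞 k, σ x = τ x := by
    intro x
    have := sub_mem_differenceIdeal σ τ x
    rw [h0, Ideal.mem_bot, sub_eq_zero] at this
    exact congrArg (fun z : 𝓞 L => (z : L)) this
  ext x
  obtain ⟨a, b, -, rfl⟩ := IsFractionRing.div_surjective (A := 𝓞 k) x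
  rw [map_div₀, map_div₀]
  exact congrArg₂ _ (h1 a) (h1 b)

theorem map_embeddingDet {F : Type*} [Field F] (ρ : L →+* F) {m : ℕ} (s : Fin m → k →+* L)
    (v : Fin m → 𝓞 k) :
    ρ (embeddingDet s v) = (Matrix.of fun i j => ρ (s i (v j))).det := by
  exact (ρ.comp (algebraMap (𝓞 L) L)).map_det _

theorem embeddingDet_injective {m : ℕ} {t : Fin m → k →+* L} {v : Fin m → 𝓞 k}
    (h : embeddingDet t v ≠ 0) : Function.Injective t := by
  intro i j hij
  by_contra hne
  exact h (Matrix.det_zero_of_row_eq hne (by ext l; simp [hij]))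

/-- Extension of a minor to a full determinant, one embedding at a time. -/
theorem minorIdeal_mul_prod_le (𝔫 : Ideal (𝓞 k)) (s : ℕ → k →+* L) {m d : ℕ} (hmd : m ≤ d) :
    minorIdeal 𝔫 (fun i : Fin m => s i) *
      ∏ j ∈ Finset.Ico m d, ((∏ i ∈ Finset.range j, differenceIdeal (s j) (s i)) *
        𝔫.map (RingOfIntegers.mapRingHom (s j))) ≤ minorIdeal 𝔫 (fun i : Fin d => s i) := by
  induction d, hmd using Nat.le_induction with
  | base => simp
  | succ d hmd ih =>
    rw [Finset.prod_Ico_succ_top hmd, ← mul_assoc]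
    have := minorIdeal_mul_le 𝔫 (fun i : Fin (d + 1) => s i)
    simp only [Fin.val_castSucc, Fin.val_last] at this
    rw [Fin.prod_univ_eq_prod_range (fun i => differenceIdeal (s d) (s i)) d] at this
    exact (Ideal.mul_mono_left ih).trans this

end Determinants

/-! ### Norms of difference ideals and of determinants -/

section Norms

variable {k L : Type*} [Field k] [Field L] [NumberField L]

theorem absNorm_map_mapRingHom [NumberField k] (σ : k →+* L) (I : Ideal (𝓞 k)) :
    Ideal.absNorm (I.map (RingOfIntegers.mapRingHom σ)) =
      Ideal.absNorm I ^ (finrank ℚ L / finrank ℚ k) := by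
  let := σ.toAlgebra
  have h1 : RingOfIntegers.mapRingHom σ = algebraMap (𝓞 k) (𝓞 L) := by ext; rfl
  rw [h1, Ideal.absNorm_algebraMap]
  have : IsScalarTower ℚ k L := inferInstance
  have h2 := finrank_mul_finrank ℚ k L
  rw [← h2, Nat.mul_div_cancel_left _ finrank_pos]
  congr 1
  exact (IsFractionRing.finrank_eq (𝓞 k) k (𝓞 L) L).symm

theorem finrank_dvd_of_ringHom [NumberField k] (σ : k →+* L) : finrank ℚ k ∣ finrank ℚ L := by
  let := σ.toAlgebra
  have : IsScalarTower ℚ k L := inferInstance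
  exact ⟨_, (finrank_mul_finrank ℚ k L).symm⟩

theorem absNorm_differenceIdeal_comp (g : L →+* L) (σ τ : k →+* L) :
    Ideal.absNorm (differenceIdeal (g.comp σ) (g.comp τ)) =
      Ideal.absNorm (differenceIdeal σ τ) := by
  rw [← map_differenceIdeal, absNorm_map_mapRingHom, Nat.div_self finrank_pos, pow_one]

/-- Passage to norms in Hilbert's factorization of the different. The norm of the different of `k`
is `|discr k|`. -/
theorem prod_absNorm_differenceIdeal_le [NumberField k] [DecidableEq (k →+* L)]
    (hcard : Fintype.card (k →+* L) = finrank ℚ k) (σ : k →+* L) :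
    ∏ τ ∈ Finset.univ.erase σ, Ideal.absNorm (differenceIdeal σ τ) ≤
      (discr k).natAbs ^ (finrank ℚ L / finrank ℚ k) := by
  have h := Ideal.absNorm_dvd_absNorm_of_le (map_differentIdeal_le hcard σ)
  rw [absNorm_map_mapRingHom, absNorm_differentIdeal k, map_prod] at h
  exact Nat.le_of_dvd (pow_pos (Int.natAbs_pos.2 (discr_ne_zero k)) _) h

theorem natAbs_norm_eq_prod [IsGalois ℚ L] (ι : L →+* ℂ) (z : 𝓞 L) :
    ((Algebra.norm ℤ z).natAbs : ℝ) = ∏ g : L ≃ₐ[ℚ] L, ‖ι (g z)‖ := by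
  rw [← norm_prod, ← map_prod, ← Algebra.norm_eq_prod_automorphisms ℚ, ← Algebra.coe_norm_int]
  simp [Nat.cast_natAbs]

/-- The Leibniz formula bounds a determinant in terms of bounds for its columns. -/
theorem norm_det_le {m : ℕ} (A : Matrix (Fin m) (Fin m) ℂ) (B : Fin m → ℝ)
    (h : ∀ i j, ‖A i j‖ ≤ B j) : ‖A.det‖ ≤ m.factorial * ∏ j, B j := by
  rw [Matrix.det_apply]
  refine (norm_sum_le _ _).trans ?_
  have : ∀ π : Equiv.Perm (Fin m), ‖Equiv.Perm.sign π • ∏ j, A (π j) j‖ ≤ ∏ j, B j := by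
    intro π
    rcases Int.units_eq_one_or (Equiv.Perm.sign π) with h1 | h1 <;> rw [h1] <;>
    · simp only [one_smul, Units.neg_smul, norm_neg, norm_prod]
      exact Finset.prod_le_prod (fun _ _ => norm_nonneg _) fun _ _ => h _ _
  refine (Finset.sum_le_sum fun π _ => this π).trans ?_
  rw [Finset.sum_const, Finset.card_univ, Fintype.card_perm, Fintype.card_fin, nsmul_eq_mul]

/-- The Galois conjugates of a determinant `(s i (v j))` are determinants of the same form, so that
all of them satisfy the same bound. -/
theorem absNorm_span_embeddingDet_le [IsGalois ℚ L] {m : ℕ} (s : Fin m → k →+* L)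
    (v : Fin m → 𝓞 k) (B : Fin m → ℝ) (hB : ∀ (ρ : k →+* ℂ) j, ‖ρ (v j)‖ ≤ B j) :
    (Ideal.absNorm (Ideal.span {embeddingDet s v}) : ℝ) ≤
      (m.factorial * ∏ j, B j) ^ finrank ℚ L := by
  obtain ⟨ι⟩ : Nonempty (L →+* ℂ) := inferInstance
  rw [Ideal.absNorm_span_singleton, natAbs_norm_eq_prod ι, ← IsGalois.card_aut_eq_finrank ℚ L,
    Nat.card_eq_fintype_card, ← Finset.card_univ]
  rw [← Finset.prod_const]
  refine Finset.prod_le_prod (fun _ _ => norm_nonneg _) fun g _ => ?_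
  have := map_embeddingDet (ι.comp (g : L →+* L)) s v
  change ι (g (embeddingDet s v)) = _ at this
  rw [this]
  exact norm_det_le _ _ fun i j => hB ((ι.comp (g : L →+* L)).comp (s i)) j

/-- Linearly independent elements have a nonvanishing minor, by Artin's independence of
characters. -/
theorem exists_embedding_det_ne_zero [NumberField k]
    (hcard : Fintype.card (k →+* L) = finrank ℚ k) {m : ℕ} {v : Fin m → 𝓞 k}
    (hv : LinearIndependent ℚ fun j => (v j : k)) :
    ∃ t : Fin m → k →+* L, embeddingDet t v ≠ 0 := by
  -- the embeddings form a basis of the `L`-valued linear forms on `k`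
  have htop : Submodule.span L (Set.range (AlgHom.toLinearMap : (k →ₐ[ℚ] L) → k →ₗ[ℚ] L)) = ⊤ := by
    refine (linearIndependent_toLinearMap ℚ k L).span_eq_top_of_card_eq_finrank' ?_
    rw [Module.finrank_linearMap_self, ← hcard]
    exact (Fintype.card_congr (RingHom.equivRatAlgHom k L)).symm
  let A : Matrix (k →+* L) (Fin m) L := Matrix.of fun σ j => σ (v j)
  have hA : LinearIndependent L A.col := by
    rw [Fintype.linearIndependent_iff]
    intro c hc j
    obtain ⟨f, hf⟩ : ∃ f : k →ₗ[ℚ] L, ∀ i, f (v i) = if i = j then 1 else 0 := by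
      obtain ⟨f, hf⟩ :=
        ((Basis.span hv).constr ℚ fun i => if i = j then (1 : L) else 0).exists_extend
      refine ⟨f, fun i => ?_⟩
      have := congrArg (fun g => g (Basis.span hv i)) hf
      simp only [LinearMap.comp_apply, Basis.constr_basis] at this
      rw [← this, Submodule.subtype_apply, Basis.span_apply]
    have h1 : ∀ f ∈ Submodule.span L (Set.range (AlgHom.toLinearMap : (k →ₐ[ℚ] L) → k →ₗ[ℚ] L)),
        ∑ i, c i * f (v i) = 0 := by
      intro f hf
      induction hf using Submodule.span_induction with
      | mem f h =>
        obtain ⟨σ, rfl⟩ := h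
        have := congrFun hc (σ : k →+* L)
        simpa [A] using this
      | zero => simp
      | add f g _ _ hf hg => simp [mul_add, Finset.sum_add_distrib, hf, hg]
      | smul a f _ hf =>
        have : ∑ i, c i * (a • f) (v i) = a * ∑ i, c i * f (v i) := by
          rw [Finset.mul_sum]
          exact Finset.sum_congr rfl fun i _ => by simp [mul_left_comm]
        rw [this, hf, mul_zero]
    have h2 := h1 f (htop ▸ Submodule.mem_top)
    simpa [hf] using h2
  have hrank : A.rank = m := by
    rw [← Matrix.rank_transpose]
    have : LinearIndependent L A.transpose.row := hA
    simpa using this.rank_matrix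
  rw [Matrix.rank_eq_finrank_span_row] at hrank
  obtain ⟨f, hf, -, hfli⟩ := Submodule.exists_fun_fin_finrank_span_eq L (Set.range A.row)
  choose t ht using hf
  refine ⟨fun i => t (Fin.cast hrank.symm i), fun h0 => ?_⟩
  have h3 : (Matrix.of fun i j => t (Fin.cast hrank.symm i) (v j)).det = 0 := by
    have := map_embeddingDet (RingHom.id L) (fun i => t (Fin.cast hrank.symm i)) v
    rw [h0] at this
    simpa using this.symm
  have h4 : LinearIndependent L (Matrix.of fun i j => t (Fin.cast hrank.symm i) (v j)).row := by
    have hrow : (Matrix.of fun i j => t (Fin.cast hrank.symm i) (v j)).row =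
        f ∘ Fin.cast hrank.symm := by
      ext i j
      exact congrFun (ht (Fin.cast hrank.symm i)) j
    rw [hrow]
    exact hfli.comp (Fin.cast hrank.symm) (Fin.cast_injective _)
  rw [Matrix.linearIndependent_rows_iff_isUnit, Matrix.isUnit_iff_isUnit_det, h3] at h4
  exact not_isUnit_zero h4

/-- An injective tuple extends to an enumeration of the whole type. The values of `s` at arguments
`≥ d` are irrelevant. -/
theorem exists_bijective_extension {α : Type*} [Fintype α] [Nonempty α] {d m : ℕ}
    (hcard : Fintype.card α = d) (hm : m ≤ d) {t : Fin m → α} (ht : Function.Injective t) :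
    ∃ s : ℕ → α, (∀ i : Fin m, s i = t i) ∧ Function.Bijective fun i : Fin d => s i := by
  classical
  let f : Fin d → α := fun i => if h : (i : ℕ) < m then t ⟨i, h⟩ else Classical.arbitrary α
  obtain ⟨g, hg⟩ := Finset.exists_equiv_extend_of_card_eq (α := Fin d)
    (t := (Finset.univ : Finset α))
    (by rw [Fintype.card_fin, Finset.card_univ, hcard])
    (s := Finset.univ.filter fun i : Fin d => (i : ℕ) < m) (f := f) (Finset.subset_univ _) (by
      intro i hi j hj hij
      simp only [Finset.coe_filter, Finset.mem_univ, true_and, Set.mem_ofPred_eq] at hi hj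
      simp only [f, dif_pos hi, dif_pos hj] at hij
      have := congrArg Fin.val (ht hij)
      exact Fin.ext this)
  refine ⟨fun n => if h : n < d then g ⟨n, h⟩ else Classical.arbitrary α, fun i => ?_, ?_⟩
  · have hid : (i : ℕ) < d := i.2.trans_le hm
    have := hg ⟨i, hid⟩ (by simp)
    simp only [dif_pos hid, this, f]
    simp
  · have h1 : (fun i : Fin d => if h : (i : ℕ) < d then (g ⟨i, h⟩ : α)
        else Classical.arbitrary α) = fun i => (g i : α) := by
      ext i
      simp
    rw [h1]
    refine ⟨fun i j hij => g.injective (Subtype.ext hij), fun a => ?_⟩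
    exact ⟨g.symm ⟨a, Finset.mem_univ a⟩, by simp⟩

/-- An integral basis of `k`, indexed by `Fin d`; the square of the determinant of its conjugates is
the discriminant. -/
theorem exists_basis_embeddingDet_sq [NumberField k] {d : ℕ} (hd : finrank ℚ k = d) :
    ∃ b : Basis (Fin d) ℤ (𝓞 k), ∀ ρ : Fin d → k →+* ℂ, Function.Bijective ρ →
      (Matrix.of fun i j => ρ i (b j)).det ^ 2 = (discr k : ℂ) := by
  let e : Free.ChooseBasisIndex ℤ (𝓞 k) ≃ Fin d := Fintype.equivFinOfCardEq (by
    rw [← finrank_eq_card_chooseBasisIndex, RingOfIntegers.rank, hd])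
  refine ⟨(RingOfIntegers.basis k).reindex e, fun ρ hρ => ?_⟩
  have h1 := Algebra.discr_eq_det_embeddingsMatrixReindex_pow_two ℚ ℂ
    (((integralBasis k).reindex e : Basis (Fin d) ℚ k) : Fin d → k)
    ((Equiv.ofBijective ρ hρ).trans (RingHom.equivRatAlgHom k ℂ))
  rw [Basis.coe_reindex, Algebra.discr_reindex, ← coe_discr] at h1
  rw [← Matrix.det_transpose]
  have h2 : (algebraMap ℚ ℂ) (discr k : ℚ) = (discr k : ℂ) := by simp
  rw [← h2, h1]
  congr 2
  ext i j
  simp [Algebra.embeddingsMatrixReindex, Algebra.embeddingsMatrix]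

theorem comp_bijective [NumberField k] (hcard : Fintype.card (k →+* L) = finrank ℚ k)
    (ι : L →+* ℂ) {d : ℕ} {s : Fin d → k →+* L} (hs : Function.Bijective s) :
    Function.Bijective fun i => ι.comp (s i) := by
  rw [Fintype.bijective_iff_injective_and_card]
  constructor
  · intro i j hij
    apply hs.1
    ext x
    exact ι.injective (congrArg (fun f : k →+* ℂ => f x) hij)
  · rw [Embeddings.card, ← hcard]
    exact Fintype.card_of_bijective hs

/-- The norm to `ℚ` of the determinant of an integral basis, whose square is the discriminant. -/
theorem absNorm_span_embeddingDet_sq [NumberField k]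
    (hcard : Fintype.card (k →+* L) = finrank ℚ k) {d : ℕ} {b : Basis (Fin d) ℤ (𝓞 k)}
    (hb : ∀ ρ : Fin d → k →+* ℂ, Function.Bijective ρ →
      (Matrix.of fun i j => ρ i (b j)).det ^ 2 = (discr k : ℂ))
    {s : Fin d → k →+* L} (hs : Function.Bijective s) :
    Ideal.absNorm (Ideal.span {embeddingDet s b}) ^ 2 = (discr k).natAbs ^ finrank ℚ L := by
  obtain ⟨ι⟩ : Nonempty (L →+* ℂ) := inferInstance
  have h1 : embeddingDet s b ^ 2 = algebraMap ℤ (𝓞 L) (discr k) := by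
    apply RingOfIntegers.ext
    apply ι.injective
    have h2 := hb _ (comp_bijective hcard ι hs)
    have h3 := map_embeddingDet ι s b
    change (Matrix.of fun i j => ι (s i (b j))).det ^ 2 = _ at h2
    rw [← h3] at h2
    simpa using h2
  rw [← map_pow, Ideal.span_singleton_pow, h1, Ideal.absNorm_span_singleton,
    Algebra.norm_algebraMap, Int.natAbs_pow, RingOfIntegers.rank]

end Norms

/-! ### Lower bounds for linearly independent elements of an ideal -/

section LowerBound

variable {k L : Type*} [Field k] [NumberField k] [Field L] [NumberField L]

theorem prod_erase_eq {α M : Type*} [Fintype α] [DecidableEq α] [CommMonoid M] {d : ℕ} {s : ℕ → α}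
    (hs : Function.Bijective fun i : Fin d => s i) (f : α → M) {j : ℕ} (hj : j < d) :
    ∏ i ∈ (Finset.range d).erase j, f (s i) = ∏ a ∈ Finset.univ.erase (s j), f a := by
  have hinj : ∀ i < d, ∀ i' < d, s i = s i' → i = i' := fun i hi i' hi' h =>
    congrArg Fin.val (@hs.1 ⟨i, hi⟩ ⟨i', hi'⟩ h)
  refine Finset.prod_bij (fun i _ => s i) ?_ ?_ ?_ fun _ _ => rfl
  · intro i hi
    simp only [Finset.mem_erase, Finset.mem_range, Finset.mem_univ, and_true] at hi ⊢
    exact fun h => hi.1 (hinj _ hi.2 _ hj h)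
  · intro i hi i' hi' h
    simp only [Finset.mem_erase, Finset.mem_range] at hi hi'
    exact hinj _ hi.2 _ hi'.2 h
  · intro a ha
    obtain ⟨i, rfl⟩ := hs.2 a
    refine ⟨i, ?_, rfl⟩
    simp only [Finset.mem_erase, Finset.mem_range, Finset.mem_univ, and_true] at ha ⊢
    exact ⟨fun h => ha (by rw [← h]), i.2⟩

/-- Extraction of the `r`-th root from an inequality between norms from a field of degree
`r = d * q`. -/
theorem rpow_mul_rpow_le_of_pow_le {D N Y A E P ε : ℝ} {d m q r : ℕ} (hD : 0 < D) (hN : 0 < N)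
    (hY : 0 ≤ Y) (hd : 0 < d) (hr0 : r ≠ 0) (hrq : r = d * q) (hm : m ≤ d) (hE0 : 0 ≤ E)
    (hE : E ≤ (D ^ ε) ^ q) (hA0 : 0 ≤ A) (hA : A ^ 2 = D ^ r) (hP : P ≤ Y ^ r)
    (h : A * N ^ r ≤ P * (E * (N ^ q) ^ (d - m))) :
    D ^ (1 / 2 - ε / d) * N ^ ((m : ℝ) / d) ≤ Y := by
  have hdR : (d : ℝ) ≠ 0 := by exact_mod_cast hd.ne'
  have hA' : A = D ^ ((r : ℝ) / 2) := by
    rw [← Real.sqrt_sq hA0, hA, Real.sqrt_eq_rpow, ← Real.rpow_natCast, ← Real.rpow_mul hD.le]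
    congr 1
    ring
  refine (pow_le_pow_iff_left₀ (by positivity) hY hr0).1 ?_
  have h1 : A * N ^ r ≤ Y ^ r * ((D ^ ε) ^ q * (N ^ q) ^ (d - m)) :=
    h.trans (mul_le_mul hP (mul_le_mul_of_nonneg_right hE (by positivity)) (by positivity)
      (by positivity))
  have h2 : (D ^ (1 / 2 - ε / d) * N ^ ((m : ℝ) / d)) ^ r * ((D ^ ε) ^ q * (N ^ q) ^ (d - m)) =
      A * N ^ r := by
    rw [hA', mul_pow]
    simp only [← Real.rpow_natCast, ← Real.rpow_mul hD.le, ← Real.rpow_mul hN.le]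
    rw [mul_mul_mul_comm, ← Real.rpow_add hD, ← Real.rpow_add hN]
    congr 2
    · rw [hrq]; push_cast; field_simp; ring
    · rw [hrq, Nat.cast_sub hm]; push_cast; field_simp; ring
  rw [← h2] at h1
  exact le_of_mul_le_mul_right h1 (by positivity)

/-- The lower bound for linearly independent elements of an ideal, in terms of a bound for the norm
of the product of the difference ideals of the pairs of embeddings that do not belong to the
chosen minor. -/
theorem rpow_discr_mul_rpow_absNorm_le [IsGalois ℚ L]
    (hcard : Fintype.card (k →+* L) = finrank ℚ k) {d m : ℕ} (hd : finrank ℚ k = d) (hm : m ≤ d)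
    {𝔫 : Ideal (𝓞 k)} (h𝔫 : 𝔫 ≠ ⊥) {v : Fin m → 𝓞 k}
    (hv : LinearIndependent ℚ fun j => (v j : k)) (hvn : ∀ j, v j ∈ 𝔫) {B : Fin m → ℝ}
    (hB : ∀ (ρ : k →+* ℂ) j, ‖ρ (v j)‖ ≤ B j) {ε : ℝ}
    (hε : ∀ s : ℕ → k →+* L, (Function.Bijective fun i : Fin d => s i) →
      ((∏ j ∈ Finset.Ico m d, ∏ i ∈ Finset.range j,
        Ideal.absNorm (differenceIdeal (s j) (s i)) : ℕ) : ℝ) ≤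
          (|(discr k : ℝ)| ^ ε) ^ (finrank ℚ L / d)) :
    |(discr k : ℝ)| ^ (1 / 2 - ε / d) * (Ideal.absNorm 𝔫 : ℝ) ^ ((m : ℝ) / d) ≤
      m.factorial * ∏ j, B j := by
  have hd0 : 0 < d := hd ▸ finrank_pos
  have : Nonempty (k →+* L) := Fintype.card_pos_iff.1 (by rw [hcard, hd]; exact hd0)
  obtain ⟨t, ht⟩ := exists_embedding_det_ne_zero hcard hv
  obtain ⟨s, hst, hs⟩ := exists_bijective_extension (hcard.trans hd) hm (embeddingDet_injective ht)
  obtain ⟨b, hb⟩ := exists_basis_embeddingDet_sq hd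
  have hinj : ∀ i < d, ∀ i' < d, s i = s i' → i = i' := fun i hi i' hi' h =>
    congrArg Fin.val (@hs.1 ⟨i, hi⟩ ⟨i', hi'⟩ h)
  have ht' : (fun i : Fin m => s i) = t := funext hst
  have hmem : Ideal.span {embeddingDet t v} ≤ minorIdeal 𝔫 (fun i : Fin m => s i) := by
    rw [Ideal.span_singleton_le_iff_mem, ht']
    exact Ideal.subset_span ⟨v, hvn, rfl⟩
  have hle := (Ideal.mul_mono_left hmem).trans
    ((minorIdeal_mul_prod_le 𝔫 s hm).trans (minorIdeal_le_span b h𝔫 fun i : Fin d => s i))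
  set r := finrank ℚ L with hr
  set q := r / d with hq
  have hrq : r = d * q := by
    rw [hq, Nat.mul_div_cancel']
    rw [← hd]
    exact finrank_dvd_of_ringHom (Classical.arbitrary (k →+* L))
  have hN0 : 0 < Ideal.absNorm 𝔫 := Nat.pos_of_ne_zero (by rwa [Ne, Ideal.absNorm_eq_zero_iff])
  have hdvd := Ideal.absNorm_dvd_absNorm_of_le hle
  rw [← Ideal.span_singleton_mul_span_singleton, map_mul, map_mul, map_prod] at hdvd
  simp only [map_mul, map_prod, absNorm_map_mapRingHom, hd] at hdvd
  rw [← hr, ← hq, Finset.prod_mul_distrib, Finset.prod_const, Nat.card_Ico] at hdvd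
  have hNspan : Ideal.absNorm (Ideal.span {(Ideal.absNorm 𝔫 : 𝓞 L)}) = Ideal.absNorm 𝔫 ^ r := by
    have : (Ideal.absNorm 𝔫 : 𝓞 L) = algebraMap ℤ (𝓞 L) (Ideal.absNorm 𝔫 : ℤ) := by simp
    rw [this, Ideal.absNorm_span_singleton, Algebra.norm_algebraMap, Int.natAbs_pow,
      RingOfIntegers.rank, Int.natAbs_natCast]
  rw [hNspan] at hdvd
  have hpos : 0 < Ideal.absNorm (Ideal.span {embeddingDet t v}) *
      ((∏ j ∈ Finset.Ico m d, ∏ i ∈ Finset.range j,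
        Ideal.absNorm (differenceIdeal (s j) (s i))) * (Ideal.absNorm 𝔫 ^ q) ^ (d - m)) := by
    refine Nat.mul_pos (Nat.pos_of_ne_zero ?_) (Nat.mul_pos (Finset.prod_pos fun j hj =>
      Finset.prod_pos fun i hi => Nat.pos_of_ne_zero ?_) (pow_pos (pow_pos hN0 _) _))
    · rw [Ne, Ideal.absNorm_eq_zero_iff, Ideal.span_singleton_eq_bot]
      exact ht
    · rw [Ne, Ideal.absNorm_eq_zero_iff]
      rw [Finset.mem_Ico] at hj
      rw [Finset.mem_range] at hi
      refine differenceIdeal_ne_bot fun h => hi.ne' (hinj _ hj.2 _ (hi.trans hj.2) h)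
  have hnat := Nat.le_of_dvd hpos hdvd
  have hD0 : 0 < |(discr k : ℝ)| := abs_pos.2 (by exact_mod_cast discr_ne_zero k)
  have hB0 : ∀ j, 0 ≤ B j := fun j =>
    (norm_nonneg _).trans (hB (Classical.arbitrary (k →+* ℂ)) j)
  have hA : (Ideal.absNorm (Ideal.span {embeddingDet (fun i : Fin d => s i) b}) : ℝ) ^ 2 =
      |(discr k : ℝ)| ^ r := by
    rw [← Int.cast_abs, ← Nat.cast_natAbs]
    exact_mod_cast absNorm_span_embeddingDet_sq hcard hb hs
  refine rpow_mul_rpow_le_of_pow_le hD0 (Nat.cast_pos.2 hN0)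
    (mul_nonneg (Nat.cast_nonneg _) (Finset.prod_nonneg fun j _ => hB0 j)) hd0
    (finrank_pos (R := ℚ) (M := L)).ne' hrq hm (Nat.cast_nonneg _) (hε s hs) (Nat.cast_nonneg _) hA
    (absNorm_span_embeddingDet_le t v B hB) ?_
  have := (Nat.cast_le (α := ℝ)).2 hnat
  rw [Nat.cast_mul, Nat.cast_mul, Nat.cast_mul, Nat.cast_pow, Nat.cast_pow, Nat.cast_pow] at this
  exact this

/-- The pairs outside a minor of size `d - 1` are those that contain one fixed embedding, so that
Hilbert's factorization of the different bounds their contribution. -/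
theorem lower_bound_codim_one [IsGalois ℚ L]
    (hcard : Fintype.card (k →+* L) = finrank ℚ k) {d m : ℕ} (hd : finrank ℚ k = d) (hm : m + 1 = d)
    {𝔫 : Ideal (𝓞 k)} (h𝔫 : 𝔫 ≠ ⊥) {v : Fin m → 𝓞 k}
    (hv : LinearIndependent ℚ fun j => (v j : k)) (hvn : ∀ j, v j ∈ 𝔫) {B : Fin m → ℝ}
    (hB : ∀ (ρ : k →+* ℂ) j, ‖ρ (v j)‖ ≤ B j) :
    |(discr k : ℝ)| ^ (1 / 2 - 1 / d : ℝ) * (Ideal.absNorm 𝔫 : ℝ) ^ ((m : ℝ) / d) ≤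
      m.factorial * ∏ j, B j := by
  classical
  refine rpow_discr_mul_rpow_absNorm_le hcard hd (by omega) h𝔫 hv hvn hB fun s hs => ?_
  subst hm
  rw [Nat.Ico_succ_singleton, Finset.prod_singleton, Real.rpow_one]
  have h1 := prod_absNorm_differenceIdeal_le hcard (s m)
  rw [← prod_erase_eq hs _ (Nat.lt_succ_self m), Finset.range_add_one,
    Finset.erase_insert Finset.notMem_range_self, hd] at h1
  have h2 : |(discr k : ℝ)| = ((discr k).natAbs : ℝ) := by rw [Nat.cast_natAbs, Int.cast_abs]
  rw [h2]
  exact_mod_cast h1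

/-- There are no pairs outside a minor of full size. -/
theorem lower_bound_full [IsGalois ℚ L]
    (hcard : Fintype.card (k →+* L) = finrank ℚ k) {d : ℕ} (hd : finrank ℚ k = d)
    {𝔫 : Ideal (𝓞 k)} (h𝔫 : 𝔫 ≠ ⊥) {v : Fin d → 𝓞 k}
    (hv : LinearIndependent ℚ fun j => (v j : k)) (hvn : ∀ j, v j ∈ 𝔫) {B : Fin d → ℝ}
    (hB : ∀ (ρ : k →+* ℂ) j, ‖ρ (v j)‖ ≤ B j) :
    |(discr k : ℝ)| ^ (1 / 2 : ℝ) * (Ideal.absNorm 𝔫 : ℝ) ≤ d.factorial * ∏ j, B j := by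
  have h := rpow_discr_mul_rpow_absNorm_le hcard hd le_rfl h𝔫 hv hvn hB (ε := 0)
    fun s hs => by simp
  have hd0 : (d : ℝ) ≠ 0 := by
    have : 0 < d := hd ▸ finrank_pos
    exact_mod_cast this.ne'
  simpa [div_self hd0] using h

/-- If all pairs of embeddings are conjugate, then all difference ideals have the same norm `e`, and
`e ^ (d - 1) ≤ |discr k| ^ ([L : ℚ] / d)`. -/
theorem lower_bound_two_homogeneous [IsGalois ℚ L]
    (hcard : Fintype.card (k →+* L) = finrank ℚ k) {d m : ℕ} (hd : finrank ℚ k = d) (hm : m < d)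
    (hd1 : 1 < d)
    (hhom : ∀ σ τ σ' τ' : k →+* L, σ ≠ τ → σ' ≠ τ' → ∃ g : L →+* L,
      (g.comp σ = σ' ∧ g.comp τ = τ') ∨ (g.comp σ = τ' ∧ g.comp τ = σ'))
    {𝔫 : Ideal (𝓞 k)} (h𝔫 : 𝔫 ≠ ⊥) {v : Fin m → 𝓞 k}
    (hv : LinearIndependent ℚ fun j => (v j : k)) (hvn : ∀ j, v j ∈ 𝔫) {B : Fin m → ℝ}
    (hB : ∀ (ρ : k →+* ℂ) j, ‖ρ (v j)‖ ≤ B j) :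
    |(discr k : ℝ)| ^ ((m : ℝ) * (m - 1) / (2 * d * (d - 1))) *
      (Ideal.absNorm 𝔫 : ℝ) ^ ((m : ℝ) / d) ≤ m.factorial * ∏ j, B j := by
  classical
  have hdR : (0 : ℝ) < d := by exact_mod_cast (by omega : 0 < d)
  have hdR1 : (0 : ℝ) < d - 1 := by
    have : (1 : ℝ) < d := by exact_mod_cast hd1
    linarith
  -- the number of pairs of embeddings outside the minor, divided by `d - 1`
  set ε : ℝ := (d * (d - 1) - m * (m - 1)) / (2 * (d - 1)) with hε
  have hexp : (m : ℝ) * (m - 1) / (2 * d * (d - 1)) = 1 / 2 - ε / d := by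
    rw [hε]; field_simp; ring
  rw [hexp]
  refine rpow_discr_mul_rpow_absNorm_le hcard hd hm.le h𝔫 hv hvn hB fun s hs => ?_
  have hinj : ∀ i < d, ∀ i' < d, s i = s i' → i = i' := fun i hi i' hi' h =>
    congrArg Fin.val (@hs.1 ⟨i, hi⟩ ⟨i', hi'⟩ h)
  have h01 : s 0 ≠ s 1 := fun h => by
    have := hinj 0 (by omega) 1 hd1 h
    omega
  set e := Ideal.absNorm (differenceIdeal (s 0) (s 1)) with he
  have hconst : ∀ σ τ : k →+* L, σ ≠ τ → Ideal.absNorm (differenceIdeal σ τ) = e := by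
    intro σ τ hne
    obtain ⟨g, ⟨h1, h2⟩ | ⟨h1, h2⟩⟩ := hhom _ _ σ τ h01 hne
    · rw [← h1, ← h2, absNorm_differenceIdeal_comp]
    · rw [differenceIdeal_comm, ← h1, ← h2, absNorm_differenceIdeal_comp]
  set q := finrank ℚ L / d with hq
  have hbound : e ^ (d - 1) ≤ (discr k).natAbs ^ q := by
    have h1 := prod_absNorm_differenceIdeal_le hcard (s 0)
    rw [Finset.prod_congr rfl fun τ hτ => hconst _ _ (Finset.ne_of_mem_erase hτ).symm,
      Finset.prod_const, Finset.card_erase_of_mem (Finset.mem_univ _), Finset.card_univ, hcard,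
      hd] at h1
    exact h1
  have hprod : ∏ j ∈ Finset.Ico m d, ∏ i ∈ Finset.range j,
      Ideal.absNorm (differenceIdeal (s j) (s i)) = e ^ ∑ j ∈ Finset.Ico m d, j := by
    rw [← Finset.prod_pow_eq_pow_sum]
    refine Finset.prod_congr rfl fun j hj => ?_
    rw [Finset.mem_Ico] at hj
    rw [Finset.prod_congr rfl fun i hi => hconst _ _ fun h =>
      (Finset.mem_range.1 hi).ne' (hinj _ hj.2 _ ((Finset.mem_range.1 hi).trans hj.2) h),
      Finset.prod_const, Finset.card_range]
  have hsum : ((∑ j ∈ Finset.Ico m d, j : ℕ) : ℝ) = (d - 1) * ε := by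
    have h1 : ∀ n : ℕ, ((∑ j ∈ Finset.range n, j : ℕ) : ℝ) = n * (n - 1) / 2 := by
      intro n
      induction n with
      | zero => simp
      | succ n ih => rw [Finset.sum_range_succ, Nat.cast_add, ih]; push_cast; ring
    have h2 := Finset.sum_range_add_sum_Ico (fun j => j) hm.le
    have h3 := congrArg (Nat.cast : ℕ → ℝ) h2
    rw [Nat.cast_add, h1, h1] at h3
    rw [hε]
    field_simp
    linarith
  set D := |(discr k : ℝ)| with hD
  have hD0 : 0 < D := abs_pos.2 (by exact_mod_cast discr_ne_zero k)
  have hε0 : 0 ≤ ε := by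
    have : 0 ≤ (d - 1) * ε := hsum ▸ Nat.cast_nonneg _
    exact nonneg_of_mul_nonneg_right this hdR1
  have hbR : (e : ℝ) ^ ((d : ℝ) - 1) ≤ D ^ (q : ℝ) := by
    have : D = ((discr k).natAbs : ℝ) := by rw [hD, Nat.cast_natAbs, Int.cast_abs]
    rw [this, Real.rpow_natCast, ← Nat.cast_pred (by omega), Real.rpow_natCast]
    exact_mod_cast hbound
  rw [hprod, Nat.cast_pow, ← Real.rpow_natCast, hsum, ← Real.rpow_natCast (D ^ ε),
    ← Real.rpow_mul hD0.le, mul_comm ε, Real.rpow_mul (Nat.cast_nonneg _), Real.rpow_mul hD0.le]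
  exact Real.rpow_le_rpow (by positivity) hbR hε0

end LowerBound

/-! ### The compositum of the conjugate fields -/

section GaloisClosure

variable (k : Type*) [Field k] [NumberField k]

theorem galoisClosure_eq_normalClosure :
    galoisClosure k = IntermediateField.normalClosure ℚ k ℂ := by
  apply le_antisymm
  · exact iSup_le fun σ => le_iSup (fun f : k →ₐ[ℚ] ℂ => f.fieldRange) σ.toRatAlgHom
  · refine iSup_le fun f => ?_
    have : f = (f : k →+* ℂ).toRatAlgHom := by ext; rfl
    rw [this]
    exact le_iSup (fun σ : k →+* ℂ => σ.toRatAlgHom.fieldRange) (f : k →+* ℂ)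

instance : NumberField (galoisClosure k) where
  to_charZero := inferInstance
  to_finiteDimensional := by
    rw [galoisClosure_eq_normalClosure]
    infer_instance

instance : IsGalois ℚ (galoisClosure k) := by
  rw [galoisClosure_eq_normalClosure]
  have : IsNormalClosure ℚ k (IntermediateField.normalClosure ℚ k ℂ) :=
    Algebra.IsAlgebraic.isNormalClosure_normalClosure fun _ => IsAlgClosed.splits _
  have : Normal ℚ (IntermediateField.normalClosure ℚ k ℂ) :=
    IsNormalClosure.normal (K := k)
  exact ⟨⟩

theorem galoisClosure_val_comp_bijective :
    Function.Bijective fun σ : k →+* galoisClosure k =>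
      ((algebraMap (galoisClosure k) ℂ).comp σ : k →+* ℂ) := by
  constructor
  · intro σ τ h
    ext x
    exact congrArg (fun f : k →+* ℂ => f x) h
  · intro σ
    exact ⟨σ.codRestrict (galoisClosure k) fun x =>
      le_iSup (fun τ : k →+* ℂ => τ.toRatAlgHom.fieldRange) σ ⟨x, rfl⟩, by ext; rfl⟩

theorem card_embeddings_galoisClosure :
    Fintype.card (k →+* galoisClosure k) = finrank ℚ k := by
  rw [Fintype.card_of_bijective (galoisClosure_val_comp_bijective k), Embeddings.card]

variable {k}

/-- Two-homogeneity, expressed by embeddings into the compositum and by ordered pairs. -/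
theorem IsTwoHomogeneous.exists_comp_eq (h : IsTwoHomogeneous k) (σ τ σ' τ' : k →+* galoisClosure k)
    (hne : σ ≠ τ) (hne' : σ' ≠ τ') : ∃ g : galoisClosure k →+* galoisClosure k,
      (g.comp σ = σ' ∧ g.comp τ = τ') ∨ (g.comp σ = τ' ∧ g.comp τ = σ') := by
  have hinj := (galoisClosure_val_comp_bijective k).1
  set Φ := fun σ : k →+* galoisClosure k =>
      ((algebraMap (galoisClosure k) ℂ).comp σ : k →+* ℂ) with hΦ
  obtain ⟨g, hg⟩ := h {Φ σ, Φ τ} {Φ σ', Φ τ'} (Set.ncard_pair (hinj.ne hne))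
    (Set.ncard_pair (hinj.ne hne'))
  have hact : ∀ ρ, galoisAct g (Φ ρ) = Φ ((g : galoisClosure k →+* galoisClosure k).comp ρ) := by
    intro ρ
    ext x
    rfl
  rw [Set.image_pair, hact, hact, Set.pair_eq_pair_iff] at hg
  refine ⟨g, hg.imp (fun h => ⟨hinj h.1, hinj h.2⟩) fun h => ⟨hinj h.1, hinj h.2⟩⟩

end GaloisClosure

/-! ### The lattice of an ideal -/

section Lattice

variable {k : Type*} [Field k] [NumberField k]

open scoped ComplexConjugate

theorem norm_embedding_le (x : k) (ρ : k →+* ℂ) : ‖ρ x‖ ≤ ‖minkowskiEmbedding k x‖ :=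
  PiLp.norm_apply_le (minkowskiEmbedding k x : EuclideanSpace ℂ (k →+* ℂ)) ρ

theorem norm_sq_minkowskiEmbedding (x : k) :
    ‖minkowskiEmbedding k x‖ ^ 2 = ∑ ρ : k →+* ℂ, ‖ρ x‖ ^ 2 :=
  EuclideanSpace.norm_sq_eq (minkowskiEmbedding k x : EuclideanSpace ℂ (k →+* ℂ))

/-- The sum on the right-hand side is real, as it is invariant under conjugation of the
embeddings. -/
theorem polarForm_minkowskiEmbedding (x y : k) :
    (polarForm (minkowskiEmbedding k x) (minkowskiEmbedding k y) : ℂ) =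
      ∑ ρ : k →+* ℂ, conj (ρ x) * ρ y := by
  have h1 : polarForm (minkowskiEmbedding k x) (minkowskiEmbedding k y) =
      ∑ ρ : k →+* ℂ, (conj (ρ x) * ρ y).re := by
    rw [polarForm, ← map_add, norm_sq_minkowskiEmbedding, norm_sq_minkowskiEmbedding,
      norm_sq_minkowskiEmbedding, ← Finset.sum_sub_distrib, ← Finset.sum_sub_distrib,
      Finset.sum_div]
    refine Finset.sum_congr rfl fun ρ _ => ?_
    rw [map_add, ← Complex.normSq_eq_norm_sq, ← Complex.normSq_eq_norm_sq,
      ← Complex.normSq_eq_norm_sq]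
    simp only [Complex.normSq_apply, Complex.add_re, Complex.add_im, Complex.mul_re,
      Complex.conj_re, Complex.conj_im]
    ring
  rw [h1, ← Complex.re_sum]
  rw [← Complex.conj_eq_iff_re, map_sum]
  refine Fintype.sum_equiv (ComplexEmbedding.involutive_conjugate k).toPerm _ _ fun ρ => ?_
  simp [ComplexEmbedding.conjugate_coe_eq]

/-- The norm of `minkowskiSpace` comes from an inner product. -/
theorem minkowskiSpace_parallelogram (x y : minkowskiSpace k) :
    ‖x + y‖ * ‖x + y‖ + ‖x - y‖ * ‖x - y‖ = 2 * (‖x‖ * ‖x‖ + ‖y‖ * ‖y‖) := by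
  simp only [← sq]
  exact parallelogram_law_with_norm ℂ (x : EuclideanSpace ℂ (k →+* ℂ))
    (y : EuclideanSpace ℂ (k →+* ℂ))

/-- The discriminant of a tuple of integers of `k`. -/
theorem det_sq_eq {d : ℕ} {b : Basis (Fin d) ℤ (𝓞 k)}
    (hb : ∀ ρ : Fin d → k →+* ℂ, Function.Bijective ρ →
      (Matrix.of fun i j => ρ i (b j)).det ^ 2 = (discr k : ℂ))
    {ρ : Fin d → k →+* ℂ} (hρ : Function.Bijective ρ) (v : Fin d → 𝓞 k) :
    (Matrix.of fun i j => ρ i (v j)).det ^ 2 = (discr k : ℂ) * (b.det v : ℂ) ^ 2 := by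
  have : (Matrix.of fun i j => ρ i (v j)) = (Matrix.of fun i j => ρ i (b j)) *
        (b.toMatrix v).map (Int.castRingHom ℂ) := by
    ext i j
    rw [Matrix.of_apply, Matrix.mul_apply]
    conv_lhs => rw [← b.sum_repr (v j)]
    simp [Basis.toMatrix_apply, mul_comm]
  rw [this, Matrix.det_mul, mul_pow, hb ρ hρ, Basis.det_apply]
  congr 2
  exact ((Int.castRingHom ℂ).map_det _).symm

/-- The image of an ideal is a full lattice. Its Gram determinant is the discriminant of a `ℤ`-basis
of the ideal, up to sign. -/
theorem exists_generators_idealLattice {d : ℕ} (hd : finrank ℚ k = d) {𝔫 : Ideal (𝓞 k)}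
    (h𝔫 : 𝔫 ≠ ⊥) :
    ∃ w : Fin d → minkowskiSpace k, LinearIndependent ℝ w ∧
      ⊤ ≤ Submodule.span ℝ (Set.range w) ∧
      (∀ y, y ∈ idealLattice k 𝔫 ↔ ∃ c : Fin d → ℤ, ∑ j, c j • w j = y) ∧
      (Matrix.of fun i j => polarForm (w i) (w j)).det =
        |(discr k : ℝ)| * (Ideal.absNorm 𝔫 : ℝ) ^ 2 := by
  obtain ⟨b, hb⟩ := exists_basis_embeddingDet_sq hd
  let ρ : Fin d ≃ (k →+* ℂ) := (Fintype.equivFinOfCardEq ((Embeddings.card k ℂ).trans hd)).symm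
  let c : Basis (Fin d) ℤ 𝔫 := 𝔫.selfBasis b h𝔫
  set M : Matrix (Fin d) (Fin d) ℂ := Matrix.of fun i j => ρ i ((c j : 𝓞 k) : k) with hM
  have hdet : M.det ^ 2 = (discr k : ℂ) * (b.det (fun j => (c j : 𝓞 k)) : ℂ) ^ 2 :=
    det_sq_eq hb ρ.bijective _
  have hNabs : (b.det (fun j => (c j : 𝓞 k))).natAbs = Ideal.absNorm 𝔫 :=
    Ideal.natAbs_det_basis_change b 𝔫 c
  have hN0 : Ideal.absNorm 𝔫 ≠ 0 := by rwa [Ne, Ideal.absNorm_eq_zero_iff]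
  have hdet0 : M.det ≠ 0 := by
    intro h0
    rw [h0, zero_pow two_ne_zero, eq_comm, mul_eq_zero] at hdet
    rcases hdet with h | h
    · exact discr_ne_zero k (by exact_mod_cast h)
    · have h' := pow_eq_zero_iff two_ne_zero |>.1 h
      rw [Int.cast_eq_zero] at h'
      rw [h', Int.natAbs_zero] at hNabs
      exact hN0 hNabs.symm
  let w : Fin d → minkowskiSpace k := fun j => minkowskiEmbedding k ((c j : 𝓞 k) : k)
  have hw : ∀ j i, (w j : EuclideanSpace ℂ (k →+* ℂ)) (ρ i) = M i j := fun _ _ => rfl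
  have hMinj : ∀ a : Fin d → ℂ, M.mulVec a = 0 → a = 0 := fun a ha =>
    Matrix.eq_zero_of_mulVec_eq_zero hdet0 ha
  have hli : LinearIndependent ℝ w := by
    rw [Fintype.linearIndependent_iff]
    intro a ha j
    have h1 : (fun j => (a j : ℂ)) = 0 := by
      apply hMinj
      ext i
      have := congrArg (fun z : minkowskiSpace k => (z : EuclideanSpace ℂ (k →+* ℂ)) (ρ i)) ha
      simpa [Matrix.mulVec, dotProduct, hw, mul_comm] using this
    exact Complex.ofReal_eq_zero.1 (congrFun h1 j)
  have hspan : ⊤ ≤ Submodule.span ℝ (Set.range w) := by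
    rintro z -
    -- the complex coordinates of `z` are real, because `z` is invariant under conjugation
    set a : Fin d → ℂ := M⁻¹.mulVec fun i => (z : EuclideanSpace ℂ (k →+* ℂ)) (ρ i) with ha
    have hMa : ∀ i, ∑ j, M i j * a j = (z : EuclideanSpace ℂ (k →+* ℂ)) (ρ i) := by
      intro i
      have : M.mulVec a = fun i => (z : EuclideanSpace ℂ (k →+* ℂ)) (ρ i) := by
        rw [ha, Matrix.mulVec_mulVec, Matrix.mul_nonsing_inv _ (isUnit_iff_ne_zero.2 hdet0),
          Matrix.one_mulVec]
      exact congrFun this i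
    have hMσ : ∀ σ : k →+* ℂ, ∑ j, σ ((c j : 𝓞 k) : k) * a j =
        (z : EuclideanSpace ℂ (k →+* ℂ)) σ := by
      intro σ
      have := hMa (ρ.symm σ)
      simpa [hM] using this
    have hreal : (fun j => a j - conj (a j)) = 0 := by
      apply hMinj
      ext i
      have h1 := congrArg conj (hMσ (ComplexEmbedding.conjugate (ρ i)))
      rw [z.2 (ρ i), Complex.conj_conj, ← hMσ (ρ i), map_sum] at h1
      simp only [map_mul, ComplexEmbedding.conjugate_coe_eq, Complex.conj_conj] at h1
      simp only [Matrix.mulVec, dotProduct, hM, Matrix.of_apply, mul_sub, Finset.sum_sub_distrib,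
        Pi.zero_apply]
      rw [h1, sub_self]
    have hz : z = ∑ j, (a j).re • w j := by
      apply Subtype.ext
      ext σ
      rw [← hMσ σ]
      have hc : ∀ j, ((a j).re : ℂ) = a j := fun j =>
        Complex.conj_eq_iff_re.1 (sub_eq_zero.1 (congrFun hreal j)).symm
      have : (((∑ j, (a j).re • w j : minkowskiSpace k) : EuclideanSpace ℂ (k →+* ℂ)) σ) =
          ∑ j, ((a j).re : ℂ) * σ ((c j : 𝓞 k) : k) := by
        simp [w, minkowskiEmbedding]
      rw [this]
      exact Finset.sum_congr rfl fun j _ => by rw [hc, mul_comm]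
    rw [hz]
    exact Submodule.sum_mem _ fun j _ => Submodule.smul_mem _ _ (Submodule.subset_span ⟨j, rfl⟩)
  refine ⟨w, hli, hspan, fun y => ?_, ?_⟩
  · have hsum : ∀ n : Fin d → ℤ, ∑ j, n j • w j =
        minkowskiEmbedding k (((∑ j, n j • c j : 𝔫) : 𝓞 k) : k) := by
      intro n
      have : (((∑ j, n j • c j : 𝔫) : 𝓞 k) : k) = ∑ j, n j • ((c j : 𝓞 k) : k) := by
        push_cast
        simp
      rw [this, map_sum]
      exact Finset.sum_congr rfl fun j _ => (map_smul _ _ _).symm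
    constructor
    · rintro ⟨x, hx, rfl⟩
      refine ⟨c.equivFun ⟨x, hx⟩, ?_⟩
      rw [hsum, c.sum_equivFun]
      rfl
    · rintro ⟨n, rfl⟩
      rw [hsum]
      exact ⟨_, (∑ j, n j • c j : 𝔫).2, rfl⟩
  · have hG : (Matrix.of fun i j => polarForm (w i) (w j)).map (Complex.ofRealHom) =
        M.conjTranspose * M := by
      ext i j
      simp only [Matrix.map_apply, Matrix.of_apply, Matrix.mul_apply, Matrix.conjTranspose_apply,
        w, Complex.ofRealHom_eq_coe, polarForm_minkowskiEmbedding]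
      exact (Equiv.sum_comp ρ _).symm
    have h2 : (((Matrix.of fun i j => polarForm (w i) (w j)).det : ℝ) : ℂ) =
        ((‖M.det ^ 2‖ : ℝ) : ℂ) := by
      have := Complex.ofRealHom.map_det (Matrix.of fun i j => polarForm (w i) (w j))
      rw [Complex.ofRealHom_eq_coe] at this
      rw [this]
      change ((Matrix.of fun i j => polarForm (w i) (w j)).map Complex.ofRealHom).det = _
      rw [hG, Matrix.det_mul, Matrix.det_conjTranspose, norm_pow, Complex.ofReal_pow]
      exact Complex.conj_mul' _
    rw [Complex.ofReal_inj.1 h2, hdet, norm_mul, norm_pow, Complex.norm_intCast,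
      Complex.norm_intCast, ← hNabs, Nat.cast_natAbs, Int.cast_abs]

theorem linearIndependent_rat_of_minkowskiEmbedding {m : ℕ} {x : Fin m → k}
    (h : LinearIndependent ℝ fun j => minkowskiEmbedding k (x j)) : LinearIndependent ℚ x := by
  rw [← LinearIndependent.iff_fractionRing ℤ ℚ]
  refine LinearIndependent.of_comp (minkowskiEmbedding k) ?_
  exact h.restrict_scalars' ℤ

/-- Nonzero elements of an ideal are not short, as the norm of the ideal divides their norms. -/
theorem absNorm_le_norm_pow {𝔫 : Ideal (𝓞 k)} {x : 𝓞 k} (hx : x ∈ 𝔫) (hx0 : x ≠ 0) :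
    (Ideal.absNorm 𝔫 : ℝ) ≤ ‖minkowskiEmbedding k (x : k)‖ ^ finrank ℚ k := by
  have h1 := Ideal.absNorm_dvd_absNorm_of_le ((Ideal.span_singleton_le_iff_mem _).2 hx)
  rw [Ideal.absNorm_span_singleton] at h1
  have h2 : Ideal.absNorm 𝔫 ≤ (Algebra.norm ℤ x).natAbs :=
    Nat.le_of_dvd (Int.natAbs_pos.2 (Algebra.norm_ne_zero_iff.2 hx0)) h1
  have h3 : ((Algebra.norm ℤ x).natAbs : ℝ) = ∏ ρ : k →+* ℂ, ‖ρ x‖ := by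
    have := Algebra.norm_eq_prod_embeddings ℚ ℂ (x : k)
    rw [← Algebra.coe_norm_int] at this
    have h4 := congrArg norm this
    rw [norm_prod] at h4
    rw [Fintype.prod_equiv (RingHom.equivRatAlgHom k ℂ) (fun ρ : k →+* ℂ => ‖ρ x‖)
      (fun ρ => ‖ρ (x : k)‖) fun ρ => rfl, ← h4]
    simp [Nat.cast_natAbs]
  calc (Ideal.absNorm 𝔫 : ℝ) ≤ ((Algebra.norm ℤ x).natAbs : ℝ) := by exact_mod_cast h2
    _ = ∏ ρ : k →+* ℂ, ‖ρ x‖ := h3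
    _ ≤ ∏ _ρ : k →+* ℂ, ‖minkowskiEmbedding k (x : k)‖ :=
      Finset.prod_le_prod (fun _ _ => norm_nonneg _) fun ρ _ => norm_embedding_le _ ρ
    _ = _ := by rw [Finset.prod_const, Finset.card_univ, Embeddings.card]

end Lattice

/-! ### Bounds for the successive minima of an ideal -/

section Assembly

/-- The lower bound for the product of the first `m` of the numbers `a i`, from the bounds for the
product of all of them and for the product of all but the last. These give an upper bound for the
last one, hence for the product of the last `d - m`. -/
theorem lower_bound_of_codim_one {d m : ℕ} (hm : m < d) {a : ℕ → ℝ} {D N Q : ℝ} (hD : 1 ≤ D)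
    (hN : 0 < N) (hQ : 1 ≤ Q) (ha : ∀ i < d, 0 < a i) (hmono : ∀ i < d, a i ≤ a (d - 1))
    (hupper : ∏ i ∈ Finset.range d, a i ≤ Q * (D ^ (1 / 2 : ℝ) * N))
    (hlower : D ^ (1 / 2 : ℝ) * N ≤ Q * ∏ i ∈ Finset.range d, a i)
    (hcodim : D ^ (1 / 2 - 1 / d : ℝ) * N ^ (((d - 1 : ℕ) : ℝ) / d) ≤
      Q * ∏ i ∈ Finset.range (d - 1), a i)
    (hnorm : ∀ i < d, N ^ (1 / d : ℝ) ≤ a i) :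
    D ^ max 0 ((m : ℝ) / d - 1 / 2) * N ^ ((m : ℝ) / d) ≤
      Q ^ (2 * d + 1) * ∏ i ∈ Finset.range m, a i := by
  have hD0 : 0 < D := by linarith
  have hd : 0 < d := by omega
  have hdR : (d : ℝ) ≠ 0 := by exact_mod_cast hd.ne'
  have hQ0 : 0 < Q := by linarith
  have hPm : 0 < ∏ i ∈ Finset.range m, a i :=
    Finset.prod_pos fun i hi => ha i ((Finset.mem_range.1 hi).trans hm)
  rcases le_or_gt ((m : ℝ) / d - 1 / 2) 0 with h | h
  · rw [max_eq_left h, Real.rpow_zero, one_mul]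
    calc N ^ ((m : ℝ) / d) = (N ^ (1 / d : ℝ)) ^ m := by
          rw [← Real.rpow_natCast, ← Real.rpow_mul hN.le]; congr 1; ring
      _ = ∏ i ∈ Finset.range m, N ^ (1 / d : ℝ) := by simp
      _ ≤ ∏ i ∈ Finset.range m, a i := Finset.prod_le_prod (fun _ _ => by positivity)
          fun i hi => hnorm i ((Finset.mem_range.1 hi).trans hm)
      _ ≤ _ := le_mul_of_one_le_left hPm.le (one_le_pow₀ hQ)
  · rw [max_eq_right h.le]
    have hlast : a (d - 1) ≤ Q ^ 2 * (D ^ (1 / d : ℝ) * N ^ (1 / d : ℝ)) := by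
      have h1 : (∏ i ∈ Finset.range (d - 1), a i) * a (d - 1) = ∏ i ∈ Finset.range d, a i := by
        rw [← Finset.prod_range_succ, Nat.sub_add_cancel hd]
      have hX : 0 < D ^ (1 / 2 - 1 / d : ℝ) * N ^ (((d - 1 : ℕ) : ℝ) / d) := by positivity
      refine le_of_mul_le_mul_left ?_ hX
      calc _ ≤ (Q * ∏ i ∈ Finset.range (d - 1), a i) * a (d - 1) :=
            mul_le_mul_of_nonneg_right hcodim (ha _ (by omega)).le
        _ = Q * ∏ i ∈ Finset.range d, a i := by rw [mul_assoc, h1]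
        _ ≤ Q * (Q * (D ^ (1 / 2 : ℝ) * N)) := by gcongr
        _ = Q ^ 2 * ((D ^ (1 / 2 - 1 / d : ℝ) * D ^ (1 / d : ℝ)) *
              (N ^ (((d - 1 : ℕ) : ℝ) / d) * N ^ (1 / d : ℝ))) := by
            rw [← Real.rpow_add hD0, ← Real.rpow_add hN, Nat.cast_pred hd, sub_add_cancel,
              ← add_div, sub_add_cancel, div_self hdR, Real.rpow_one]
            ring
        _ = _ := by ring
    have htail : ∏ i ∈ Finset.Ico m d, a i ≤
        Q ^ (2 * d) * (D ^ (1 - (m : ℝ) / d) * N ^ (1 - (m : ℝ) / d)) := by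
      have hpow : ∀ X : ℝ, 0 < X → (X ^ (1 / d : ℝ)) ^ (d - m) = X ^ (1 - (m : ℝ) / d) := by
        intro X hX
        rw [← Real.rpow_natCast, ← Real.rpow_mul hX.le, Nat.cast_sub hm.le]
        congr 1
        field_simp
      calc ∏ i ∈ Finset.Ico m d, a i
          ≤ ∏ i ∈ Finset.Ico m d, Q ^ 2 * (D ^ (1 / d : ℝ) * N ^ (1 / d : ℝ)) :=
            Finset.prod_le_prod (fun i hi => (ha i (Finset.mem_Ico.1 hi).2).le)
              fun i hi => (hmono i (Finset.mem_Ico.1 hi).2).trans hlast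
        _ = Q ^ (2 * (d - m)) * (D ^ (1 - (m : ℝ) / d) * N ^ (1 - (m : ℝ) / d)) := by
            rw [Finset.prod_const, Nat.card_Ico, mul_pow, mul_pow, hpow D hD0, hpow N hN, pow_mul]
        _ ≤ _ := by gcongr; exact Nat.sub_le _ _
    have hX : 0 < D ^ (1 - (m : ℝ) / d) * N ^ (1 - (m : ℝ) / d) := by positivity
    refine le_of_mul_le_mul_right ?_ hX
    calc _ = (D ^ ((m : ℝ) / d - 1 / 2) * D ^ (1 - (m : ℝ) / d)) *
          (N ^ ((m : ℝ) / d) * N ^ (1 - (m : ℝ) / d)) := by ring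
      _ = D ^ (1 / 2 : ℝ) * N := by
          rw [← Real.rpow_add hD0, ← Real.rpow_add hN, add_sub_cancel, Real.rpow_one]
          congr 2
          ring
      _ ≤ Q * ∏ i ∈ Finset.range d, a i := hlower
      _ = Q * ((∏ i ∈ Finset.range m, a i) * ∏ i ∈ Finset.Ico m d, a i) := by
          rw [Finset.prod_range_mul_prod_Ico _ hm.le]
      _ ≤ Q * ((∏ i ∈ Finset.range m, a i) *
          (Q ^ (2 * d) * (D ^ (1 - (m : ℝ) / d) * N ^ (1 - (m : ℝ) / d)))) := by gcongr
      _ = _ := by ring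

/-- An upper bound for the product of the last minima follows from a lower bound for the product of
the first ones. -/
theorem upper_bound_of_lower_bound {d m : ℕ} (hm : m < d) {a : ℕ → ℝ} {D N C Q α β : ℝ}
    (hD : 0 < D) (hN : 0 < N) (hC : 0 ≤ C) (ha : ∀ i < d, 0 < a i) (hαβ : α + β = 1 / 2)
    (hupper : ∏ i ∈ Finset.range d, a i ≤ Q * (D ^ (1 / 2 : ℝ) * N))
    (hlower : D ^ α * N ^ ((m : ℝ) / d) ≤ C * ∏ i ∈ Finset.range m, a i) :
    ∏ i ∈ Finset.Ico m d, a i ≤ C * Q * (D ^ β * N ^ (1 - (m : ℝ) / d)) := by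
  have hX : 0 < D ^ α * N ^ ((m : ℝ) / d) := by positivity
  refine le_of_mul_le_mul_left ?_ hX
  calc _ ≤ (C * ∏ i ∈ Finset.range m, a i) * ∏ i ∈ Finset.Ico m d, a i :=
        mul_le_mul_of_nonneg_right hlower
          (Finset.prod_nonneg fun i hi => (ha i (Finset.mem_Ico.1 hi).2).le)
    _ = C * ∏ i ∈ Finset.range d, a i := by
        rw [mul_assoc, Finset.prod_range_mul_prod_Ico _ hm.le]
    _ ≤ C * (Q * (D ^ (1 / 2 : ℝ) * N)) := by gcongr
    _ = C * Q * ((D ^ α * D ^ β) * (N ^ ((m : ℝ) / d) * N ^ (1 - (m : ℝ) / d))) := by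
        rw [← Real.rpow_add hD, ← Real.rpow_add hN, add_sub_cancel, Real.rpow_one, hαβ]
        ring
    _ = _ := by ring

variable {k : Type*} [Field k] [NumberField k]

/-- Minkowski's second theorem for the lattice of an ideal, in terms of the Gram determinant
of a basis. -/
theorem exists_realizing_vectors_idealLattice {d : ℕ} (𝔫 : Ideal (𝓞 k))
    {w : Fin d → minkowskiSpace k} (hw : LinearIndependent ℝ w)
    (hspan : ⊤ ≤ Submodule.span ℝ (Set.range w))
    (hL : ∀ y, y ∈ idealLattice k 𝔫 ↔ ∃ c : Fin d → ℤ, ∑ j, c j • w j = y) :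
    ∃ v : Fin d → minkowskiSpace k, (∀ i, v i ∈ idealLattice k 𝔫) ∧ LinearIndependent ℝ v ∧
      (∀ i : Fin d, successiveMinimum (idealLattice k 𝔫) (i + 1) = ‖v i‖) ∧
      (∀ i j, i ≤ j → ‖v i‖ ≤ ‖v j‖) ∧
      ∏ i, ‖v i‖ ≤ √d ^ d * √(Matrix.of fun i j => polarForm (w i) (w j)).det :=
  @exists_realizing_vectors (minkowskiSpace k) _ _ d minkowskiSpace_parallelogram
    (idealLattice k 𝔫) w hw hspan hL

/-- Elements of an ideal whose images realize the successive minima. -/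
theorem exists_minimal_elements {d : ℕ} (hd : finrank ℚ k = d) {𝔫 : Ideal (𝓞 k)} (h𝔫 : 𝔫 ≠ ⊥) :
    ∃ x : Fin d → 𝓞 k, (∀ i, x i ∈ 𝔫) ∧ (LinearIndependent ℚ fun i => (x i : k)) ∧
      (∀ i : Fin d, successiveMinimum (idealLattice k 𝔫) (i + 1) =
        ‖minkowskiEmbedding k (x i : k)‖) ∧
      (∀ i j : Fin d, i ≤ j → ‖minkowskiEmbedding k (x i : k)‖ ≤ ‖minkowskiEmbedding k (x j : k)‖) ∧
      ∏ i, ‖minkowskiEmbedding k (x i : k)‖ ≤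
        √d ^ d * (|(discr k : ℝ)| ^ (1 / 2 : ℝ) * Ideal.absNorm 𝔫) := by
  obtain ⟨w, hw, hspan, hL, hgram⟩ := exists_generators_idealLattice hd h𝔫
  obtain ⟨v, hv, hli, hlam, hmono, hprod⟩ :=
    exists_realizing_vectors_idealLattice 𝔫 hw hspan hL
  rw [hgram, Real.sqrt_mul (abs_nonneg _), Real.sqrt_sq (Nat.cast_nonneg _),
    Real.sqrt_eq_rpow |(discr k : ℝ)|] at hprod
  have hx : ∀ i, ∃ x ∈ 𝔫, minkowskiEmbedding k ((x : 𝓞 k) : k) = v i := fun i => by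
    obtain ⟨x, hx, h⟩ := hv i
    exact ⟨x, hx, h⟩
  choose x hx hxv using hx
  have hlix : LinearIndependent ℝ fun i => minkowskiEmbedding k (x i : k) := by
    rw [funext hxv]
    exact hli
  refine ⟨x, hx, linearIndependent_rat_of_minkowskiEmbedding hlix, fun i => ?_,
    fun i j hij => ?_, ?_⟩
  · rw [hxv]; exact hlam i
  · rw [hxv, hxv]; exact hmono i j hij
  · rw [Finset.prod_congr rfl fun i _ => congrArg norm (hxv i)]; exact hprod

end Assembly

end IdealLatticeMinima

end


theorem mainTheorem3 (d : ℕ) :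
    ∃ C : ℝ, 0 < C ∧
      ∀ (k : Type*) [Field k] [NumberField k], Module.finrank ℚ k = d →
      ∀ 𝔫 : Ideal (NumberField.RingOfIntegers k), 𝔫 ≠ ⊥ →
      ∀ m : ℕ, 1 ≤ m → m < d →
        let lam : ℕ → ℝ := 
          IdealLatticeMinima.successiveMinimum (IdealLatticeMinima.idealLattice k 𝔫)
        let D : ℝ := |(NumberField.discr k : ℝ)|
        let N : ℝ := ((Submodule.toAddSubgroup 𝔫).index : ℝ)
        (D ^ (max 0 ((m : ℝ) / d - 1 / 2)) * N ^ ((m : ℝ) / d)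
            ≤ C * ∏ i ∈ Finset.Icc 1 m, lam i) ∧
        (∏ i ∈ Finset.Icc (m + 1) d, lam i
            ≤ C * (D ^ (min (1 / 2) (1 - (m : ℝ) / d)) * N ^ (1 - (m : ℝ) / d))) ∧
        (IdealLatticeMinima.IsTwoHomogeneous k →
          (D ^ ((m : ℝ) * (m - 1) / (2 * d * (d - 1))) * N ^ ((m : ℝ) / d)
              ≤ C * ∏ i ∈ Finset.Icc 1 m, lam i) ∧
          (∏ i ∈ Finset.Icc (m + 1) d, lam i
              ≤ C * (D ^ (((d : ℝ) - m) * (d + m - 1) / (2 * d * (d - 1)))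
                  * N ^ (1 - (m : ℝ) / d)))) := by
  open IdealLatticeMinima in
  have hK : (1 : ℝ) ≤ √d ^ d := by
    rcases Nat.eq_zero_or_pos d with rfl | hd
    · simp
    · exact one_le_pow₀ (Real.one_le_sqrt.2 (by exact_mod_cast hd))
  have hfac : (1 : ℝ) ≤ d.factorial := by exact_mod_cast Nat.factorial_pos d
  -- `Q` bounds both the constant `√d ^ d` of Minkowski's second theorem and the factors `n!`, for
  -- `n ≤ d`, from the estimates of determinants
  set Q : ℝ := d.factorial * √d ^ d with hQ
  have hQ1 : 1 ≤ Q := one_le_mul_of_one_le_of_one_le hfac hK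
  have hfacQ : (d.factorial : ℝ) ≤ Q := le_mul_of_one_le_right (by positivity) hK
  have hKQ : √d ^ d ≤ Q := le_mul_of_one_le_left (by positivity) hfac
  refine ⟨Q ^ (2 * d + 1) * Q, by positivity, ?_⟩
  intro k _ _ hd 𝔫 h𝔫 m hm1 hm lam D N
  have hN : N = (Ideal.absNorm 𝔫 : ℝ) := rfl
  obtain ⟨x, hx, hli, hlam, hmono, hupper⟩ := exists_minimal_elements hd h𝔫
  have hcard := card_embeddings_galoisClosure k
  set a : ℕ → ℝ := fun i => lam (i + 1) with ha
  have hlam' : ∀ i : Fin d, a i = ‖minkowskiEmbedding k (x i : k)‖ := hlam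
  have hprod : ∀ (n : ℕ) (hn : n ≤ d),
      ∏ i : Fin n, ‖minkowskiEmbedding k (x (Fin.castLE hn i) : k)‖ =
      ∏ i ∈ Finset.range n, a i := by
    intro n hn
    rw [← Fin.prod_univ_eq_prod_range]
    exact Finset.prod_congr rfl fun i _ => (hlam' (Fin.castLE hn i)).symm
  have hpos : ∀ i < d, 0 < a i := fun i hi => by
    rw [hlam' ⟨i, hi⟩]
    obtain ⟨ρ⟩ : Nonempty (k →+* ℂ) := inferInstance
    have h0 : ρ (x ⟨i, hi⟩) ≠ 0 := (map_ne_zero ρ).2 (hli.ne_zero ⟨i, hi⟩)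
    exact (norm_pos_iff.2 h0).trans_le (norm_embedding_le _ ρ)
  have hD1 : 1 ≤ D := by
    change 1 ≤ |(NumberField.discr k : ℝ)|
    have := Int.one_le_abs (NumberField.discr_ne_zero k)
    exact_mod_cast this
  have hD0 : 0 < D := by linarith
  have hN0 : 0 < N := by
    rw [hN]
    exact_mod_cast Nat.pos_of_ne_zero (by rwa [Ne, Ideal.absNorm_eq_zero_iff])
  have hbound : ∀ (n : ℕ) (hn : n ≤ d) (ρ : k →+* ℂ) (j : Fin n),
      ‖ρ (x (Fin.castLE hn j))‖ ≤ ‖minkowskiEmbedding k (x (Fin.castLE hn j) : k)‖ :=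
    fun n hn ρ j => norm_embedding_le _ ρ
  have hlin : ∀ (n : ℕ) (hn : n ≤ d), LinearIndependent ℚ fun j : Fin n =>
      (x (Fin.castLE hn j) : k) := fun n hn => hli.comp _ (Fin.castLE_injective hn)
  have hfacn : ∀ n ≤ d, ∀ X : ℝ, X ≤ n.factorial * ∏ i ∈ Finset.range n, a i →
      X ≤ Q * ∏ i ∈ Finset.range n, a i := fun n hn X hX => hX.trans <|
    mul_le_mul_of_nonneg_right
      ((Nat.cast_le.2 (Nat.factorial_le hn)).trans hfacQ)
      (Finset.prod_nonneg fun i hi => (hpos i ((Finset.mem_range.1 hi).trans_le hn)).le)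
  have hup : ∏ i ∈ Finset.range d, a i ≤ Q * (D ^ (1 / 2 : ℝ) * N) := by
    rw [← hprod d le_rfl]
    exact hupper.trans (mul_le_mul_of_nonneg_right hKQ (by positivity))
  have hfull : D ^ (1 / 2 : ℝ) * N ≤ Q * ∏ i ∈ Finset.range d, a i := by
    refine hfacn d le_rfl _ ?_
    rw [← hprod d le_rfl]
    exact lower_bound_full hcard hd h𝔫 (hlin d le_rfl) (fun j => hx _) (hbound d le_rfl)
  have hcodim : D ^ (1 / 2 - 1 / d : ℝ) * N ^ (((d - 1 : ℕ) : ℝ) / d) ≤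
      Q * ∏ i ∈ Finset.range (d - 1), a i := by
    refine hfacn (d - 1) (Nat.sub_le _ _) _ ?_
    rw [← hprod (d - 1) (Nat.sub_le _ _)]
    exact lower_bound_codim_one hcard hd (by omega) h𝔫 (hlin _ _) (fun j => hx _) (hbound _ _)
  have hnorm : ∀ i < d, N ^ (1 / d : ℝ) ≤ a i := by
    intro i hi
    have h0 : x ⟨i, hi⟩ ≠ 0 := fun h => hli.ne_zero ⟨i, hi⟩ (by simp [h])
    have h1 := absNorm_le_norm_pow (hx ⟨i, hi⟩) h0
    rw [← hlam', hd, ← hN] at h1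
    have hd0 : (d : ℝ) ≠ 0 := by exact_mod_cast (by omega : d ≠ 0)
    calc N ^ (1 / d : ℝ) ≤ (a i ^ d) ^ (1 / d : ℝ) := Real.rpow_le_rpow hN0.le h1 (by positivity)
      _ = a i := by
        rw [← Real.rpow_natCast, ← Real.rpow_mul (hpos i hi).le, mul_one_div_cancel hd0,
          Real.rpow_one]
  have hIcc1 : ∏ i ∈ Finset.Icc 1 m, lam i = ∏ i ∈ Finset.range m, a i := by
    rw [Finset.range_eq_Ico, ha, Finset.prod_Ico_add' lam 0 m 1]
    rfl
  have hIcc2 : ∏ i ∈ Finset.Icc (m + 1) d, lam i = ∏ i ∈ Finset.Ico m d, a i := by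
    rw [ha, Finset.prod_Ico_add' lam m d 1]
    rfl
  have hPm : 0 ≤ ∏ i ∈ Finset.range m, a i :=
    Finset.prod_nonneg fun i hi => (hpos i ((Finset.mem_range.1 hi).trans hm)).le
  have hC1 : (0 : ℝ) ≤ Q ^ (2 * d + 1) := by positivity
  have hCQ : Q ^ (2 * d + 1) ≤ Q ^ (2 * d + 1) * Q := le_mul_of_one_le_right hC1 hQ1
  rw [hIcc1, hIcc2]
  have hlow := lower_bound_of_codim_one hm hD1 hN0 hQ1 hpos
    (fun i hi => by
      rw [hlam' ⟨i, hi⟩, hlam' ⟨d - 1, by omega⟩]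
      exact hmono _ _ (by rw [Fin.le_def]; simp; omega)) hup hfull hcodim hnorm
  refine ⟨hlow.trans (mul_le_mul_of_nonneg_right hCQ hPm),
    upper_bound_of_lower_bound hm hD0 hN0 hC1 hpos ?_ hup hlow, fun hhom => ?_⟩
  -- `min (1 / 2) (1 - m / d) = 1 / 2 - max 0 (m / d - 1 / 2)`
  · rw [← sub_sub_self (1 / 2 : ℝ) (min _ _), ← max_sub_sub_left]
    rw [sub_self, show (1 / 2 - (1 - (m : ℝ) / d)) = (m : ℝ) / d - 1 / 2 by ring, add_sub_cancel]
  · have hlow2 : D ^ ((m : ℝ) * (m - 1) / (2 * d * (d - 1))) * N ^ ((m : ℝ) / d) ≤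
        Q ^ (2 * d + 1) * ∏ i ∈ Finset.range m, a i := by
      refine (hfacn m hm.le _ ?_).trans
        (mul_le_mul_of_nonneg_right (le_self_pow₀ hQ1 (by omega)) hPm)
      rw [← hprod m hm.le]
      exact lower_bound_two_homogeneous hcard hd hm (by omega)
        (fun σ τ σ' τ' h h' => hhom.exists_comp_eq σ τ σ' τ' h h') h𝔫 (hlin _ _) (fun j => hx _)
        (hbound _ _)
    refine ⟨hlow2.trans (mul_le_mul_of_nonneg_right hCQ hPm),
      upper_bound_of_lower_bound hm hD0 hN0 hC1 hpos ?_ hup hlow2⟩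
    have hd0 : (d : ℝ) ≠ 0 := by exact_mod_cast (by omega : d ≠ 0)
    have hd1 : (d : ℝ) - 1 ≠ 0 := by
      have : (1 : ℝ) < d := by exact_mod_cast (by omega : 1 < d)
      linarith
    field_simp
    ring
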